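/- Let $\rho,\mu,\tilde\lambda>0$. For $N\ge 0$ put $a_N=(\mu/\rho)^N e^{-\mu/\rho}/N!$ and $\gamma_N(\underline v_N)=e^{-\pi|\underline v_N|^2}$ on $\mathbb R^N$, and let $$L^2_s(\mathcal R,\boldsymbol\Gamma)=\bigoplus_{N=0}^\infty L^2_s(\mathbb R^N,a_N\gamma_N)$$ be the real Hilbert space of all sequences $\mathbf h=(h_0,h_1,h_2,\dots)$ of functions $h_N:\mathbb R^N\to\mathbb R$ that are symmetric under permutations of the $v_i$ and satisfy $(\mathbf h,\mathbf h)<\infty$, with the scalar product $$(\mathbf h,\mathbf j)=\sum_{N=0}^\infty a_N\int_{\mathbb R^N} h_N(\underline v_N)\,j_N(\underline v_N)\,\gamma_N(\underline v_N)\,d\underline v_N .$$ Define $$(\mathcal P^+\mathbf h)_N(\underline v_N)=\sum_{i=1}^N h_{N-1}(v_1,\dots,v_{i-1},v_{i+1},\dots,v_N),\qquad (\mathcal P^+\mathbf h)_0=0,$$ $$(\mathcal P^-\mathbf h)_N(\underline v_N)=\frac1{N+1}\sum_{i=1}^{N+1}\int_{\mathbb R} e^{-\pi w^2}h_{N+1}(v_1,\dots,v_{i-1},w,v_i,\dots,v_N)\,dw,$$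 $(\mathcal N\mathbf h)_N=N h_N$, and $(\mathcal K\mathbf h)_N=\sum_{1\le i<j\le N}(R_{i,j}-\mathrm{Id})h_N$ with $$(R_{i,j}h_N)(\underline v_N)=\frac1{2\pi}\int_0^{2\pi}h_N(\dots,v_i\cos\theta-v_j\sin\theta,\dots,v_i\sin\theta+v_j\cos\theta,\dots)\,d\theta ,$$ where the two rotated entries stand in places $i$ and $j$. Let $$\widetilde{\mathcal L}=\rho(\mathcal P^+-\mathcal N)+\mu(\mathcal P^--\mathrm{Id})+\tilde\lambda\mathcal K$$ with domain $D^2=\{\mathbf h\in L^2_s(\mathcal R,\boldsymbol\Gamma) : \widetilde{\mathcal L}\mathbf h\in L^2_s(\mathcal R,\boldsymbol\Gamma)\}$, where $\widetilde{\mathcal L}\mathbf h$ is computed level by level. Then $\widetilde{\mathcal L}$ is a densely defined self-adjoint operator on $L^2_s(\mathcal R,\boldsymbol\Gamma)$ and it is non-positive: $(\mathbf h,\widetilde{\mathcal L}\mathbf h)\le 0$ for all $\mathbf h\in D^2$. Let $\mathbf e^0$ be the vector with $(\mathbf e^0)_N\equiv 1$ for every $N$, let $\mathbf E_0=\mathrm{span}\{\mathbf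 e^0\}$, and let $$\Delta=\sup\{(\mathbf h,\widetilde{\mathcal L}\mathbf h) : \mathbf h\in D^2,\ \|\mathbf h\|=1,\ \mathbf h\perp\mathbf E_0\}.$$ Then $\Delta=-\rho$. Moreover $\Delta$ is an eigenvalue of $\widetilde{\mathcal L}$, and its eigenspace is $\mathrm{span}\{\mathbf e_1,\mathbf e_{(0,0,1)}\}$, where $$\mathbf e_1=\sqrt{\tfrac{\rho}{\mu}}\,\mathcal P^+\mathbf e^0-\sqrt{\tfrac{\mu}{\rho}}\,\mathbf e^0,\qquad (\mathbf e_{(0,0,1)})_N(\underline v_N)=\sqrt{\tfrac{\rho}{2\mu}}\sum_{i=1}^N(2\pi v_i^2-1).$$ -/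

import Mathlib

open MeasureTheory

noncomputable section

namespace KacReservoir

/-! ### States at the level of functions

A state is a sequence `h = (h 0, h 1, …)`, where `h N` is a function of `N` velocities. -/

abbrev State : Type := (N : ℕ) → (Fin N → ℝ) → ℝ

/-- `(P⁺ h)_N (v) = ∑ᵢ h_{N-1} (v with vᵢ removed)`; in particular `(P⁺ h)_0 = 0`. -/
def Pplus (h : State) : State
  | 0, _ => 0
  | N + 1, v => ∑ i : Fin (N + 1), h N (i.removeNth v)

/-- `(P⁻ h)_N (v) = (N+1)⁻¹ ∑ᵢ ∫ e^{-π w²} h_{N+1} (v with w inserted at place i) dw`. -/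
def Pminus (h : State) : State := fun N v =>
  1 / ((N : ℝ) + 1) *
    ∑ i : Fin (N + 1), ∫ w : ℝ, Real.exp (-Real.pi * w ^ 2) * h (N + 1) (i.insertNth w v)

/-- The number operator. -/
def Num (h : State) : State := fun N v => (N : ℝ) * h N v

/-- Rotation by the angle `θ` in the plane of the velocities `vᵢ` and `vⱼ`. -/
def rot {N : ℕ} (i j : Fin N) (θ : ℝ) (v : Fin N → ℝ) : Fin N → ℝ := fun k =>
  if k = i then v i * Real.cos θ - v j * Real.sin θ
  else if k = j then v i * Real.sin θ + v j * Real.cos θ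
  else v k

/-- The collision operator `R_{i,j}`: average over all rotations in the plane `(vᵢ, vⱼ)`. -/
def Rcol {N : ℕ} (i j : Fin N) (f : (Fin N → ℝ) → ℝ) : (Fin N → ℝ) → ℝ := fun v =>
  1 / (2 * Real.pi) * ∫ θ in (0 : ℝ)..(2 * Real.pi), f (rot i j θ v)

/-- The Kac collision operator `(K h)_N = ∑_{i<j} (R_{i,j} - Id) h_N`. -/
def Kac (h : State) : State := fun N v =>
  ∑ p : Fin N × Fin N with p.1 < p.2, (Rcol p.1 p.2 (h N) v - h N v)

/-- The expression `ρ (P⁺ h - N h) + μ (P⁻ h - h) + lam K h`. -/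
def genExpr (ρ μ lam : ℝ) (h : State) : State := fun N v =>
  ρ * (Pplus h N v - Num h N v) + μ * (Pminus h N v - h N v) + lam * Kac h N v

/-- `e⁰`, constantly one on every level. -/
def stateE0 : State := fun _ _ => 1

/-- `√(ρ/μ) P⁺ e⁰ - √(μ/ρ) e⁰`. -/
def stateE1 (ρ μ : ℝ) : State := fun N v =>
  Real.sqrt (ρ / μ) * Pplus stateE0 N v - Real.sqrt (μ / ρ) * stateE0 N v

/-- `√(ρ/(2μ)) ∑ᵢ (2π vᵢ² - 1)`. -/
def stateE001 (ρ μ : ℝ) : State := fun N v =>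
  Real.sqrt (ρ / (2 * μ)) * ∑ i : Fin N, (2 * Real.pi * v i ^ 2 - 1)

/-! ### The Hilbert space -/

/-- The Poisson weights `a_N = (μ/ρ)^N e^{-μ/ρ} / N!`. -/
def weight (ρ μ : ℝ) (N : ℕ) : ℝ :=
  (μ / ρ) ^ N * Real.exp (-(μ / ρ)) / (N.factorial : ℝ)

/-- The Maxwellian `γ_N (v) = e^{-π |v|²}`. -/
def maxwell {N : ℕ} (v : Fin N → ℝ) : ℝ := Real.exp (-Real.pi * ∑ i, v i ^ 2)

/-- The measure `a_N γ_N(v) dv` on `ℝ^N`. -/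
def levelMeasure (ρ μ : ℝ) (N : ℕ) : Measure (Fin N → ℝ) :=
  (volume : Measure (Fin N → ℝ)).withDensity
    (fun v => ENNReal.ofReal (weight ρ μ N * maxwell v))

lemma measurePreserving_perm {N : ℕ} (σ : Equiv.Perm (Fin N)) :
    MeasurePreserving (fun v : Fin N → ℝ => v ∘ σ) volume volume := by
  have h := volume_measurePreserving_piCongrLeft (fun _ : Fin N => ℝ) σ.symm
  convert h using 1
  ext v k
  simp [MeasurableEquiv.coe_piCongrLeft, Equiv.piCongrLeft_apply]

lemma maxwell_pos {N : ℕ} (v : Fin N → ℝ) : 0 < maxwell v := Real.exp_pos _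

lemma continuous_maxwell {N : ℕ} : Continuous (maxwell : (Fin N → ℝ) → ℝ) := by
  unfold maxwell; fun_prop

lemma measurePreserving_level {ρ μ : ℝ} {N : ℕ} {T : (Fin N → ℝ) → (Fin N → ℝ)}
    (hT : MeasurePreserving T volume volume) (hm : ∀ v, maxwell (T v) = maxwell v) :
    MeasurePreserving T (levelMeasure ρ μ N) (levelMeasure ρ μ N) := by
  refine ⟨hT.measurable, ?_⟩
  ext s hs
  have hme : Measurable (fun v : Fin N → ℝ => ENNReal.ofReal (weight ρ μ N * maxwell v)) :=
    (continuous_const.mul continuous_maxwell).measurable.ennreal_ofReal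
  rw [Measure.map_apply hT.measurable hs, levelMeasure,
    withDensity_apply _ (hT.measurable hs), withDensity_apply _ hs]
  rw [← hT.setLIntegral_comp_preimage hs hme]
  simp only [hm]

lemma measurePreserving_perm_level (ρ μ : ℝ) {N : ℕ} (σ : Equiv.Perm (Fin N)) :
    MeasurePreserving (fun v : Fin N → ℝ => v ∘ σ)
      (levelMeasure ρ μ N) (levelMeasure ρ μ N) :=
  measurePreserving_level (measurePreserving_perm σ) fun v => by
    simp only [maxwell, Function.comp]
    rw [Equiv.sum_comp σ (fun i => v i ^ 2)]

/-- `L²_s(ℝ^N, a_N γ_N)`: square integrable functions invariant under all permutations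
of the velocities. -/
def symL2 (ρ μ : ℝ) (N : ℕ) : Submodule ℝ (Lp ℝ 2 (levelMeasure ρ μ N)) where
  carrier := {f | ∀ σ : Equiv.Perm (Fin N),
    (fun v : Fin N → ℝ => f (v ∘ σ)) =ᵐ[levelMeasure ρ μ N] f}
  zero_mem' := fun σ => by
    have h0 := Lp.coeFn_zero ℝ 2 (levelMeasure ρ μ N)
    have h1 := (measurePreserving_perm_level ρ μ σ).quasiMeasurePreserving.ae_eq_comp h0
    filter_upwards [h0, h1] with v hv hv1
    exact hv1.trans hv.symm
  add_mem' := fun {f g} hf hg σ => by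
    have h0 := Lp.coeFn_add f g
    have h1 := (measurePreserving_perm_level ρ μ σ).quasiMeasurePreserving.ae_eq_comp h0
    filter_upwards [h0, h1, hf σ, hg σ] with v hv hv1 hv2 hv3
    refine hv1.trans ?_
    rw [hv]
    simp only [Function.comp_apply, Pi.add_apply] at *
    rw [hv2, hv3]
  smul_mem' := fun c f hf σ => by
    have h0 := Lp.coeFn_smul c f
    have h1 := (measurePreserving_perm_level ρ μ σ).quasiMeasurePreserving.ae_eq_comp h0
    filter_upwards [h0, h1, hf σ] with v hv hv1 hv2
    refine hv1.trans ?_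
    rw [hv]
    simp only [Function.comp_apply, Pi.smul_apply] at *
    rw [hv2]

lemma mem_symL2_iff {ρ μ : ℝ} {N : ℕ} (f : Lp ℝ 2 (levelMeasure ρ μ N)) :
    f ∈ symL2 ρ μ N ↔ ∀ σ : Equiv.Perm (Fin N),
      Lp.compMeasurePreservingₗᵢ ℝ _ (measurePreserving_perm_level ρ μ σ) f = f := by
  refine forall_congr' fun σ => ?_
  have h := Lp.coeFn_compMeasurePreserving f (measurePreserving_perm_level ρ μ σ)
  constructor
  · intro hf
    exact Lp.ext (h.trans hf)
  · intro hf
    have h2 : (Lp.compMeasurePreserving _ (measurePreserving_perm_level ρ μ σ) f) = f := hf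
    rw [h2] at h
    exact h.symm

lemma isClosed_symL2 (ρ μ : ℝ) (N : ℕ) :
    IsClosed (symL2 ρ μ N : Set (Lp ℝ 2 (levelMeasure ρ μ N))) := by
  have : (symL2 ρ μ N : Set (Lp ℝ 2 (levelMeasure ρ μ N))) =
      ⋂ σ : Equiv.Perm (Fin N), {f | Lp.compMeasurePreservingₗᵢ ℝ _
        (measurePreserving_perm_level ρ μ σ) f = f} := by
    ext f
    simp only [SetLike.mem_coe, mem_symL2_iff, Set.mem_iInter, Set.mem_ofPred_eq]
  rw [this]
  exact isClosed_iInter fun σ => isClosed_eq (LinearIsometry.continuous _) continuous_id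

instance (ρ μ : ℝ) (N : ℕ) : CompleteSpace (symL2 ρ μ N) :=
  (isClosed_symL2 ρ μ N).completeSpace_coe

/-- The Hilbert space `L²_s(R, Γ) = ⨁_N L²_s(ℝ^N, a_N γ_N)` (Hilbert sum). -/
abbrev Space (ρ μ : ℝ) : Type := lp (fun N : ℕ => symL2 ρ μ N) 2

/-- The state (sequence of functions) underlying a vector of the Hilbert space. -/
def toState {ρ μ : ℝ} (h : Space ρ μ) : State := fun N =>
  ((h N : Lp ℝ 2 (levelMeasure ρ μ N)) : (Fin N → ℝ) → ℝ)

/-- Equality of states up to null sets on every level. -/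
def AEEqState (ρ μ : ℝ) (F G : State) : Prop :=
  ∀ N, F N =ᵐ[levelMeasure ρ μ N] G N

/-- The vector `h` of the Hilbert space is (the class of) the state `F`. -/
def Represents {ρ μ : ℝ} (h : Space ρ μ) (F : State) : Prop :=
  AEEqState ρ μ (toState h) F

/-! ### Well-definedness of the generator on classes of functions -/

lemma weight_pos {ρ μ : ℝ} (hρ : 0 < ρ) (hμ : 0 < μ) (N : ℕ) : 0 < weight ρ μ N := by
  unfold weight; positivity

lemma ae_level_iff {ρ μ : ℝ} (hρ : 0 < ρ) (hμ : 0 < μ) {N : ℕ} {p : (Fin N → ℝ) → Prop} :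
    (∀ᵐ v ∂levelMeasure ρ μ N, p v) ↔ ∀ᵐ v, p v := by
  have hm : Measurable (fun v : Fin N → ℝ => ENNReal.ofReal (weight ρ μ N * maxwell v)) :=
    (continuous_const.mul continuous_maxwell).measurable.ennreal_ofReal
  rw [levelMeasure, ae_withDensity_iff hm]
  refine Filter.eventually_congr (Filter.Eventually.of_forall fun v => ?_)
  have : ENNReal.ofReal (weight ρ μ N * maxwell v) ≠ 0 := by
    simpa using mul_pos (weight_pos hρ hμ N) (maxwell_pos v)
  simp [this]

lemma integrable_maxwell (N : ℕ) : Integrable (maxwell : (Fin N → ℝ) → ℝ) := by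
  have h : Integrable (fun v : Fin N → ℝ => ∏ i, Real.exp (-Real.pi * v i ^ 2)) :=
    Integrable.fintype_prod (f := fun _ : Fin N => fun x : ℝ => Real.exp (-Real.pi * x ^ 2))
      fun _ => integrable_exp_neg_mul_sq Real.pi_pos
  refine h.congr (Filter.Eventually.of_forall fun v => ?_)
  simp only [maxwell, Finset.mul_sum, Real.exp_sum]

instance (ρ μ : ℝ) (N : ℕ) : IsFiniteMeasure (levelMeasure ρ μ N) :=
  isFiniteMeasure_withDensity_ofReal ((integrable_maxwell N).const_mul _).2

lemma integrable_toState {ρ μ : ℝ} (hρ : 0 < ρ) (hμ : 0 < μ) (h : Space ρ μ) (N : ℕ) :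
    Integrable (fun v => maxwell v * toState h N v) := by
  have h1 : Integrable (toState h N) (levelMeasure ρ μ N) :=
    (Lp.memLp (h N : Lp ℝ 2 (levelMeasure ρ μ N))).integrable (by norm_num)
  have hm : Measurable (fun v : Fin N → ℝ => ENNReal.ofReal (weight ρ μ N * maxwell v)) :=
    (continuous_const.mul continuous_maxwell).measurable.ennreal_ofReal
  rw [levelMeasure, integrable_withDensity_iff_integrable_smul' hm (by simp)] at h1
  refine (h1.const_mul (weight ρ μ N)⁻¹).congr (Filter.Eventually.of_forall fun v => ?_)
  have hw := weight_pos hρ hμ N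
  simp only [smul_eq_mul]
  rw [ENNReal.toReal_ofReal (mul_pos hw (maxwell_pos v)).le]
  field_simp

lemma ae_removeNth {N : ℕ} (i : Fin (N + 1)) {p : (Fin N → ℝ) → Prop} (hp : ∀ᵐ v, p v) :
    ∀ᵐ v : Fin (N + 1) → ℝ, p (i.removeNth v) := by
  have h := volume_preserving_piFinSuccAbove (fun _ : Fin (N + 1) => ℝ) i
  have h2 : ∀ᵐ z : ℝ × (Fin N → ℝ), p z.2 := Measure.quasiMeasurePreserving_snd.ae hp
  exact h.quasiMeasurePreserving.ae h2

lemma ae_insertNth {N : ℕ} (i : Fin (N + 1)) {p : (Fin (N + 1) → ℝ) → Prop}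
    (hp : ∀ᵐ v, p v) : ∀ᵐ v : Fin N → ℝ, ∀ᵐ w : ℝ, p (i.insertNth w v) := by
  have h := (volume_preserving_piFinSuccAbove (fun _ : Fin (N + 1) => ℝ) i).symm
  have h2 : ∀ᵐ z : ℝ × (Fin N → ℝ), p (i.insertNth z.1 z.2) := h.quasiMeasurePreserving.ae hp
  have h3 : ∀ᵐ z : (Fin N → ℝ) × ℝ, p (i.insertNth z.2 z.1) :=
    Measure.measurePreserving_swap.quasiMeasurePreserving.ae h2
  exact Measure.ae_ae_of_ae_prod h3

lemma maxwell_insertNth {N : ℕ} (i : Fin (N + 1)) (w : ℝ) (v : Fin N → ℝ) :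
    maxwell (i.insertNth w v : Fin (N + 1) → ℝ) =
      Real.exp (-Real.pi * w ^ 2) * maxwell v := by
  simp only [maxwell]
  rw [← Real.exp_add, Fin.sum_univ_succAbove _ i]
  simp [mul_add]

lemma integrable_insertNth {N : ℕ} (i : Fin (N + 1)) {f : (Fin (N + 1) → ℝ) → ℝ}
    (hf : Integrable (fun v => maxwell v * f v)) :
    ∀ᵐ v : Fin N → ℝ,
      Integrable (fun w : ℝ => Real.exp (-Real.pi * w ^ 2) * f (i.insertNth w v)) := by
  have h := (volume_preserving_piFinSuccAbove (fun _ : Fin (N + 1) => ℝ) i).symm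
  have h2 := h.integrable_comp_of_integrable hf
  have h3 := h2.prod_left_ae
  filter_upwards [h3] with v hv
  refine (hv.const_mul (maxwell v)⁻¹).congr (Filter.Eventually.of_forall fun w => ?_)
  have hpos := maxwell_pos v
  change (maxwell v)⁻¹ * (maxwell (i.insertNth w v : Fin (N + 1) → ℝ) * f (i.insertNth w v)) = _
  rw [maxwell_insertNth]
  field_simp

lemma rot_sum_sq {N : ℕ} {i j : Fin N} (hij : i ≠ j) (θ : ℝ) (v : Fin N → ℝ) :
    ∑ k, rot i j θ v k ^ 2 = ∑ k, v k ^ 2 := by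
  have key : ∀ g : Fin N → ℝ, ∑ k, g k =
      g i + (g j + ∑ k ∈ (Finset.univ.erase i).erase j, g k) := by
    intro g
    rw [Finset.add_sum_erase _ _ (by simp [hij.symm]), Finset.add_sum_erase _ _ (by simp)]
  rw [key (fun k => rot i j θ v k ^ 2), key (fun k => v k ^ 2)]
  have h1 : ∑ k ∈ (Finset.univ.erase i).erase j, rot i j θ v k ^ 2 =
      ∑ k ∈ (Finset.univ.erase i).erase j, v k ^ 2 := by
    refine Finset.sum_congr rfl fun k hk => ?_
    simp only [Finset.mem_erase] at hk
    simp [rot, hk.1, hk.2.1]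
  rw [h1]
  simp only [rot, if_true, hij.symm, if_false]
  linear_combination (v i ^ 2 + v j ^ 2) * Real.cos_sq_add_sin_sq θ

lemma continuous_rot {N : ℕ} (i j : Fin N) :
    Continuous (fun z : ℝ × (Fin N → ℝ) => rot i j z.1 z.2) := by
  refine continuous_pi fun k => ?_
  unfold rot
  split_ifs <;> fun_prop

lemma measurePreserving_rot {N : ℕ} {i j : Fin N} (hij : i ≠ j) (θ : ℝ) :
    MeasurePreserving (rot i j θ) volume volume := by
  let L : EuclideanSpace ℝ (Fin N) →ₗᵢ[ℝ] EuclideanSpace ℝ (Fin N) :=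
    { toFun := fun x => WithLp.toLp 2 (rot i j θ (WithLp.ofLp x))
      map_add' := fun x y => by
        ext k
        simp only [rot, WithLp.ofLp_add, Pi.add_apply]
        split_ifs <;> ring
      map_smul' := fun c x => by
        ext k
        simp only [rot, WithLp.ofLp_smul, Pi.smul_apply, smul_eq_mul, RingHom.id_apply]
        split_ifs <;> ring
      norm_map' := fun x => by
        simp only [LinearMap.coe_mk, AddHom.coe_mk]
        rw [EuclideanSpace.norm_eq, EuclideanSpace.norm_eq]
        simp only [Real.norm_eq_abs, sq_abs]
        rw [rot_sum_sq hij] }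
  have h1 := (L.toLinearIsometryEquiv rfl).measurePreserving
  have h2 := (PiLp.volume_preserving_ofLp (Fin N)).comp
    (h1.comp (PiLp.volume_preserving_toLp (Fin N)))
  exact h2

lemma measurePreserving_rot_prod {N : ℕ} {i j : Fin N} (hij : i ≠ j) :
    MeasurePreserving (fun z : ℝ × (Fin N → ℝ) => (z.1, rot i j z.1 z.2))
      ((volume.restrict (Set.Ioc 0 (2 * Real.pi))).prod volume)
      ((volume.restrict (Set.Ioc 0 (2 * Real.pi))).prod volume) :=
  (MeasurePreserving.id _).skew_product (g := fun θ v => rot i j θ v)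
    (continuous_rot i j).measurable
    (Filter.Eventually.of_forall fun θ => (measurePreserving_rot hij θ).map_eq)

lemma ae_rot {N : ℕ} {i j : Fin N} (hij : i ≠ j) {p : (Fin N → ℝ) → Prop}
    (hp : ∀ᵐ v, p v) :
    ∀ᵐ v : Fin N → ℝ, ∀ᵐ θ ∂(volume.restrict (Set.Ioc 0 (2 * Real.pi))), p (rot i j θ v) := by
  have h2 : ∀ᵐ z ∂((volume.restrict (Set.Ioc 0 (2 * Real.pi))).prod
      (volume : Measure (Fin N → ℝ))), p z.2 := Measure.quasiMeasurePreserving_snd.ae hp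
  have h3 := (measurePreserving_rot_prod hij).quasiMeasurePreserving.ae h2
  have h4 := (Measure.measurePreserving_swap
    (μ := (volume : Measure (Fin N → ℝ)))
    (ν := volume.restrict (Set.Ioc 0 (2 * Real.pi)))).quasiMeasurePreserving.ae h3
  exact Measure.ae_ae_of_ae_prod h4

lemma integrable_rot {N : ℕ} {i j : Fin N} (hij : i ≠ j) {f : (Fin N → ℝ) → ℝ}
    (hf : Integrable (fun v => maxwell v * f v)) :
    ∀ᵐ v : Fin N → ℝ,
      IntervalIntegrable (fun θ => f (rot i j θ v)) volume 0 (2 * Real.pi) := by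
  have h2 := hf.comp_snd (volume.restrict (Set.Ioc 0 (2 * Real.pi)))
  have h3 := ((measurePreserving_rot_prod hij).integrable_comp_of_integrable h2).prod_left_ae
  filter_upwards [h3] with v hv
  rw [intervalIntegrable_iff_integrableOn_Ioc_of_le (by positivity)]
  refine (hv.const_mul (maxwell v)⁻¹).congr (Filter.Eventually.of_forall fun θ => ?_)
  have hpos := maxwell_pos v
  change (maxwell v)⁻¹ * (maxwell (rot i j θ v) * f (rot i j θ v)) = _
  have : maxwell (rot i j θ v) = maxwell v := by simp only [maxwell, rot_sum_sq hij]
  rw [this]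
  field_simp

lemma genExpr_lin {ρ μ lam : ℝ} {F G H : State} (a b : ℝ)
    (hF : ∀ N, Integrable (fun v => maxwell v * F N v))
    (hG : ∀ N, Integrable (fun v => maxwell v * G N v))
    (hH : ∀ N, ∀ᵐ v, H N v = a * F N v + b * G N v) (N : ℕ) :
    ∀ᵐ v, genExpr ρ μ lam H N v =
      a * genExpr ρ μ lam F N v + b * genExpr ρ μ lam G N v := by
  have hplus : ∀ᵐ v, Pplus H N v = a * Pplus F N v + b * Pplus G N v := by
    cases N with
    | zero => simp [Pplus]
    | succ N =>
      have h := ae_all_iff.2 fun i : Fin (N + 1) => ae_removeNth i (hH N)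
      filter_upwards [h] with v hv
      simp only [Pplus, hv, Finset.sum_add_distrib, Finset.mul_sum]
  have hminus : ∀ᵐ v, Pminus H N v = a * Pminus F N v + b * Pminus G N v := by
    have h := ae_all_iff.2 fun i : Fin (N + 1) => ae_insertNth i (hH (N + 1))
    have h1 := ae_all_iff.2 fun i : Fin (N + 1) => integrable_insertNth i (hF (N + 1))
    have h2 := ae_all_iff.2 fun i : Fin (N + 1) => integrable_insertNth i (hG (N + 1))
    filter_upwards [h, h1, h2] with v hv hv1 hv2
    have : ∀ i : Fin (N + 1),
        ∫ w : ℝ, Real.exp (-Real.pi * w ^ 2) * H (N + 1) (i.insertNth w v) =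
        a * (∫ w : ℝ, Real.exp (-Real.pi * w ^ 2) * F (N + 1) (i.insertNth w v)) +
        b * (∫ w : ℝ, Real.exp (-Real.pi * w ^ 2) * G (N + 1) (i.insertNth w v)) := by
      intro i
      rw [← integral_const_mul, ← integral_const_mul,
        ← integral_add ((hv1 i).const_mul a) ((hv2 i).const_mul b)]
      refine integral_congr_ae ?_
      filter_upwards [hv i] with w hw
      rw [hw]; ring
    simp only [Pminus, this, Finset.sum_add_distrib, ← Finset.mul_sum]
    ring
  have hkac : ∀ᵐ v, Kac H N v = a * Kac F N v + b * Kac G N v := by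
    have h := ae_all_iff.2 fun p : {p : Fin N × Fin N // p.1 < p.2} =>
      ae_rot (ne_of_lt p.2) (hH N)
    have h1 := ae_all_iff.2 fun p : {p : Fin N × Fin N // p.1 < p.2} =>
      integrable_rot (ne_of_lt p.2) (hF N)
    have h2 := ae_all_iff.2 fun p : {p : Fin N × Fin N // p.1 < p.2} =>
      integrable_rot (ne_of_lt p.2) (hG N)
    filter_upwards [h, h1, h2, hH N] with v hv hv1 hv2 hv3
    simp only [Kac, Finset.mul_sum]
    rw [← Finset.sum_add_distrib]
    refine Finset.sum_congr rfl fun p hp => ?_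
    have hp' : p.1 < p.2 := (Finset.mem_filter.1 hp).2
    have : ∫ θ in (0 : ℝ)..(2 * Real.pi), H N (rot p.1 p.2 θ v) =
        a * (∫ θ in (0 : ℝ)..(2 * Real.pi), F N (rot p.1 p.2 θ v)) +
        b * (∫ θ in (0 : ℝ)..(2 * Real.pi), G N (rot p.1 p.2 θ v)) := by
      rw [← intervalIntegral.integral_const_mul, ← intervalIntegral.integral_const_mul,
        ← intervalIntegral.integral_add ((hv1 ⟨p, hp'⟩).const_mul a)
          ((hv2 ⟨p, hp'⟩).const_mul b),
        intervalIntegral.integral_of_le (by positivity),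
        intervalIntegral.integral_of_le (by positivity)]
      exact integral_congr_ae (hv ⟨p, hp'⟩)
    simp only [Rcol, this, hv3]
    ring
  filter_upwards [hplus, hminus, hkac, hH N] with v h1 h2 h3 h4
  simp only [genExpr, Num, h1, h2, h3, h4]
  ring

lemma toState_lin {ρ μ : ℝ} (a b : ℝ) (h k : Space ρ μ) (N : ℕ) :
    ∀ᵐ v ∂levelMeasure ρ μ N,
      toState (a • h + b • k) N v = a * toState h N v + b * toState k N v := by
  have h0 := Lp.coeFn_add (a • (h N : Lp ℝ 2 (levelMeasure ρ μ N))) (b • (k N : Lp ℝ 2 _))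
  have h1 := Lp.coeFn_smul a (h N : Lp ℝ 2 (levelMeasure ρ μ N))
  have h2 := Lp.coeFn_smul b (k N : Lp ℝ 2 (levelMeasure ρ μ N))
  filter_upwards [h0, h1, h2] with v hv hv1 hv2
  refine hv.trans ?_
  simp only [Pi.add_apply, hv1, hv2]
  rfl

lemma Represents.unique {ρ μ : ℝ} {g g' : Space ρ μ} {F : State}
    (h : Represents g F) (h' : Represents g' F) : g = g' :=
  lp.ext (funext fun N => Subtype.ext (Lp.ext ((h N).trans (h' N).symm)))

lemma represents_lin {ρ μ lam : ℝ} (hρ : 0 < ρ) (hμ : 0 < μ) (a b : ℝ) {h k g l : Space ρ μ}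
    (hg : Represents g (genExpr ρ μ lam (toState h)))
    (hl : Represents l (genExpr ρ μ lam (toState k))) :
    Represents (a • g + b • l) (genExpr ρ μ lam (toState (a • h + b • k))) := by
  intro N
  have h0 := genExpr_lin (ρ := ρ) (μ := μ) (lam := lam) a b
    (integrable_toState hρ hμ h) (integrable_toState hρ hμ k)
    (fun N => (ae_level_iff hρ hμ).1 (toState_lin a b h k N)) N
  filter_upwards [(ae_level_iff hρ hμ).2 h0, toState_lin a b g l N, hg N, hl N]
    with v h1 h2 h3 h4
  rw [h1, h2, h3, h4]

/-! ### The generator as an unbounded operator -/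

/-- The generator `ρ (P⁺ - N) + μ (P⁻ - Id) + lam K` on its maximal domain, which consists of
all `h` in the Hilbert space for which the state `ρ (P⁺ h - N h) + μ (P⁻ h - h) + lam K h`
is again (the class of) a vector of the Hilbert space. -/
def generator (ρ μ lam : ℝ) (hρ : 0 < ρ) (hμ : 0 < μ) : Space ρ μ →ₗ.[ℝ] Space ρ μ where
  domain :=
    { carrier := {h | ∃ g : Space ρ μ, Represents g (genExpr ρ μ lam (toState h))}
      zero_mem' := by
        have h0 := genExpr_lin (ρ := ρ) (μ := μ) (lam := lam) 0 0
          (integrable_toState hρ hμ (0 : Space ρ μ)) (integrable_toState hρ hμ (0 : Space ρ μ))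
          (fun N => (ae_level_iff hρ hμ).1 (toState_lin 0 0 (0 : Space ρ μ) 0 N))
        refine ⟨0, fun N => ?_⟩
        have h1 := toState_lin 0 0 (0 : Space ρ μ) 0 N
        simp only [zero_smul, add_zero, zero_mul] at h0 h1
        filter_upwards [(ae_level_iff hρ hμ).2 (h0 N), h1] with v hv hv1
        rw [hv, hv1]
      add_mem' := by
        rintro h k ⟨g, hg⟩ ⟨l, hl⟩
        exact ⟨_, by simpa using represents_lin hρ hμ 1 1 hg hl⟩
      smul_mem' := by
        rintro c h ⟨g, hg⟩
        exact ⟨_, by simpa using represents_lin hρ hμ c 0 hg hg⟩ }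
  toFun :=
    { toFun := fun h => h.2.choose
      map_add' := fun h k => (h + k).2.choose_spec.unique (by
        simpa using represents_lin hρ hμ 1 1 h.2.choose_spec k.2.choose_spec)
      map_smul' := fun c h => (c • h).2.choose_spec.unique (by
        simpa using represents_lin hρ hμ c 0 h.2.choose_spec h.2.choose_spec) }

/-- The eigenspace of an unbounded operator `A` for `c`: all `h` in the domain of `A` with
`A h = c h`. -/
def eigenspace {H : Type*} [AddCommGroup H] [Module ℝ H] (A : H →ₗ.[ℝ] H) (c : ℝ) :
    Submodule ℝ H where
  carrier := {h | ∃ hh : h ∈ A.domain, A ⟨h, hh⟩ = c • h}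
  zero_mem' := ⟨A.domain.zero_mem, by
    rw [smul_zero]; exact A.map_zero⟩
  add_mem' := by
    rintro h k ⟨h1, h2⟩ ⟨k1, k2⟩
    refine ⟨A.domain.add_mem h1 k1, ?_⟩
    rw [smul_add, ← h2, ← k2, ← A.map_add]; rfl
  smul_mem' := by
    rintro a h ⟨h1, h2⟩
    refine ⟨A.domain.smul_mem a h1, ?_⟩
    rw [smul_comm, ← h2, ← A.map_smul]; rfl

/-- The values `(h, A h)` for `h` in the domain of `A` with `‖h‖ = 1` and `h ⊥ E`. -/
def rayleighValues {H : Type*} [NormedAddCommGroup H] [InnerProductSpace ℝ H]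
    (A : H →ₗ.[ℝ] H) (E : Submodule ℝ H) : Set ℝ :=
  {x | ∃ h : A.domain, ‖(h : H)‖ = 1 ∧ (h : H) ∈ Eᗮ ∧ x = inner ℝ (h : H) (A h)}

/-- `Δ = sup {(h, A h) | h ∈ D(A), ‖h‖ = 1, h ⊥ E}`. -/
def gap {H : Type*} [NormedAddCommGroup H] [InnerProductSpace ℝ H]
    (A : H →ₗ.[ℝ] H) (E : Submodule ℝ H) : ℝ := sSup (rayleighValues A E)

end KacReservoir

end

/-!
With `ν = μ / ρ`, the operators `P⁺`, `P⁻` and `K` enter only through a few algebraic relations: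
`P⁺` and `ν P⁻` are adjoint, `P⁻ P⁺ - P⁺ P⁻ = 1`, and `K` is symmetric and nonpositive and kills
constants, which `P⁺` and `P⁻` preserve up to a factor. Green's formula for the first `N` levels has
a boundary term bounded by `N + 1` times the `N`-th term of a convergent series; since the harmonic
series diverges, it vanishes in the limit. Hence the maximal operator is self-adjoint and
`-(h, L h)` is the sum of the nonnegative dissipations
`μ ‖P⁻ hₙ₊₁ - hₙ‖² + ρ ((n + 1) ‖hₙ₊₁‖² - ν ‖P⁻ hₙ₊₁‖²) - lam (hₙ₊₁, K hₙ₊₁)`.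

On vectors of mean zero the commutation relation gives `ν ‖P⁻ hₙ₊₁‖² ≤ n ‖hₙ₊₁‖²`, which leaves
`ρ ‖hₙ₊₁‖²`. The means of the levels form a sequence to which the Poincaré inequality of the
Poisson law applies. Together these bound the gap by `-ρ`, which `e₁` attains.

An eigenvector for `-ρ` whose level `0` vanishes has mean zero on every level and attains equality
above, so `P⁻ hₙ₊₁ = hₙ`, `P⁺ hₙ = n hₙ₊₁` and `K hₙ = 0`: it is determined by `φ = h₁`, and
`φ(v₀) + φ(v₁)` is invariant under rotations. Averaging this invariance over `v₁` makes `φ` equal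
to its Mehler average, hence continuous; then `φ √u - φ 0` solves Cauchy's functional equation, so
`φ` is a multiple of `2πv² - 1`.
-/

namespace KacReservoir

section PoissonPoincare

open Finset

lemma lagrange_identity_weighted (a c : ℕ → ℝ) (N : ℕ) :
    (∑ n ∈ range N, a n) * (∑ n ∈ range N, a n * c n ^ 2) - (∑ n ∈ range N, a n * c n) ^ 2 =
      ∑ m ∈ range N, a m * ∑ n ∈ range m, a n * (c m - c n) ^ 2 := by
  induction N with
  | zero => simp
  | succ N ih =>
    have hsq : ∑ n ∈ range N, a n * (c N - c n) ^ 2 =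
        c N ^ 2 * ∑ n ∈ range N, a n - 2 * c N * ∑ n ∈ range N, a n * c n +
          ∑ n ∈ range N, a n * c n ^ 2 := by
      simp only [mul_sum]
      rw [← sum_sub_distrib, ← sum_add_distrib]
      exact sum_congr rfl fun n _ => by ring
    simp only [sum_range_succ]
    rw [← ih, hsq]
    ring

lemma sum_mul_sq_sub_le {a : ℕ → ℝ} (ha : ∀ n, 0 ≤ a n) (c : ℕ → ℝ) (m : ℕ) :
    ∑ n ∈ range m, a n * (c m - c n) ^ 2 ≤
      ∑ k ∈ range m, (c (k + 1) - c k) ^ 2 * ∑ n ∈ range (k + 1), a n * ((m : ℝ) - n) := by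
  have h_cauchy : ∀ n ∈ range m, a n * (c m - c n) ^ 2 ≤
      ∑ k ∈ Ico n m, (c (k + 1) - c k) ^ 2 * (a n * ((m : ℝ) - n)) := by
    intro n hn
    have hnm : n ≤ m := (mem_range.1 hn).le
    have hsq := sq_sum_le_card_mul_sum_sq (s := Ico n m) (f := fun k => c (k + 1) - c k)
    rw [Nat.card_Ico, Nat.cast_sub hnm, sum_Ico_sub c hnm] at hsq
    rw [← sum_mul]
    calc a n * (c m - c n) ^ 2
        ≤ a n * (((m : ℝ) - n) * ∑ k ∈ Ico n m, (c (k + 1) - c k) ^ 2) :=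
          mul_le_mul_of_nonneg_left hsq (ha n)
      _ = _ := by ring
  refine (sum_le_sum h_cauchy).trans_eq ?_
  rw [sum_comm' (t' := range m) (s' := fun k => range (k + 1))]
  · simp only [mul_sum]
  · intro n k
    simp only [mem_range, mem_Ico]
    omega

variable {ν : ℝ} {a : ℕ → ℝ}

lemma sum_mul_cast (ha : ∀ n : ℕ, ((n : ℝ) + 1) * a (n + 1) = ν * a n) (k : ℕ) :
    ∑ n ∈ range (k + 1), a n * (n : ℝ) = ν * ∑ n ∈ range k, a n := by
  rw [sum_range_succ', mul_sum, Nat.cast_zero, mul_zero, add_zero]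
  refine sum_congr rfl fun n _ => ?_
  rw [← ha n, Nat.cast_succ, mul_comm]

lemma sum_Ico_mul_sum_mul_sub (ha : ∀ n : ℕ, ((n : ℝ) + 1) * a (n + 1) = ν * a n) {k N : ℕ}
    (hkN : k ≤ N) :
    ∑ m ∈ Ico (k + 1) (N + 1), a m * ∑ n ∈ range (k + 1), a n * ((m : ℝ) - n) =
      ν * ((∑ n ∈ range (k + 1), a n) * (∑ n ∈ range N, a n) -
        (∑ n ∈ range k, a n) * ∑ n ∈ range (N + 1), a n) := by
  have hinner : ∀ m : ℕ, a m * ∑ n ∈ range (k + 1), a n * ((m : ℝ) - n) =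
      (∑ n ∈ range (k + 1), a n) * (a m * m) - ν * (∑ n ∈ range k, a n) * a m := fun m => by
    simp only [mul_sub, sum_sub_distrib, ← sum_mul, sum_mul_cast ha]
    ring
  simp only [hinner, sum_sub_distrib, ← mul_sum]
  rw [sum_Ico_eq_sub _ (by omega), sum_Ico_eq_sub _ (by omega), sum_mul_cast ha, sum_mul_cast ha]
  ring

lemma sum_Ico_mul_sum_mul_sub_le (hν : 0 ≤ ν) (ha0 : ∀ n, 0 ≤ a n)
    (ha : ∀ n : ℕ, ((n : ℝ) + 1) * a (n + 1) = ν * a n)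
    (ha1 : ∀ N, ∑ n ∈ range N, a n ≤ 1) {k N : ℕ} (hkN : k ≤ N) :
    ∑ m ∈ Ico (k + 1) (N + 1), a m * ∑ n ∈ range (k + 1), a n * ((m : ℝ) - n) ≤ ν * a k := by
  rw [sum_Ico_mul_sum_mul_sub ha hkN]
  refine mul_le_mul_of_nonneg_left ?_ hν
  have hk : 0 ≤ ∑ n ∈ range k, a n := sum_nonneg fun n _ => ha0 n
  calc (∑ n ∈ range (k + 1), a n) * (∑ n ∈ range N, a n) -
        (∑ n ∈ range k, a n) * ∑ n ∈ range (N + 1), a n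
      = a k * (∑ n ∈ range N, a n) - (∑ n ∈ range k, a n) * a N := by
        rw [sum_range_succ, sum_range_succ]; ring
    _ ≤ a k * 1 - 0 := sub_le_sub (mul_le_mul_of_nonneg_left (ha1 N) (ha0 k))
        (mul_nonneg hk (ha0 N))
    _ = a k := by ring

lemma poisson_poincare_truncated (hν : 0 ≤ ν) (ha0 : ∀ n, 0 ≤ a n)
    (ha : ∀ n : ℕ, ((n : ℝ) + 1) * a (n + 1) = ν * a n)
    (ha1 : ∀ N, ∑ n ∈ range N, a n ≤ 1) (c : ℕ → ℝ) (N : ℕ) :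
    (∑ n ∈ range (N + 1), a n) * (∑ n ∈ range (N + 1), a n * c n ^ 2) -
        (∑ n ∈ range (N + 1), a n * c n) ^ 2 ≤
      ν * ∑ k ∈ range N, a k * (c (k + 1) - c k) ^ 2 := by
  rw [lagrange_identity_weighted]
  calc ∑ m ∈ range (N + 1), a m * ∑ n ∈ range m, a n * (c m - c n) ^ 2
      ≤ ∑ m ∈ range (N + 1), a m * ∑ k ∈ range m, (c (k + 1) - c k) ^ 2 *
          ∑ n ∈ range (k + 1), a n * ((m : ℝ) - n) :=
        sum_le_sum fun m _ => mul_le_mul_of_nonneg_left (sum_mul_sq_sub_le ha0 c m) (ha0 m)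
    _ = ∑ k ∈ range N, (c (k + 1) - c k) ^ 2 *
          ∑ m ∈ Ico (k + 1) (N + 1), a m * ∑ n ∈ range (k + 1), a n * ((m : ℝ) - n) := by
        simp only [mul_sum]
        rw [sum_comm' (t' := range N) (s' := fun k => Ico (k + 1) (N + 1))
          (fun m k => by simp only [mem_range, mem_Ico]; omega)]
        refine sum_congr rfl fun k _ => sum_congr rfl fun m _ => sum_congr rfl fun n _ => ?_
        ring
    _ ≤ ∑ k ∈ range N, (c (k + 1) - c k) ^ 2 * (ν * a k) :=
        sum_le_sum fun k hk => mul_le_mul_of_nonneg_left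
          (sum_Ico_mul_sum_mul_sub_le hν ha0 ha ha1 (mem_range.1 hk).le) (sq_nonneg _)
    _ = ν * ∑ k ∈ range N, a k * (c (k + 1) - c k) ^ 2 := by
        rw [mul_sum]
        exact sum_congr rfl fun k _ => by ring

lemma poisson_poincare (hν : 0 ≤ ν) (ha0 : ∀ n, 0 ≤ a n)
    (ha : ∀ n : ℕ, ((n : ℝ) + 1) * a (n + 1) = ν * a n) (ha1 : HasSum a 1) {c : ℕ → ℝ}
    {m s D : ℝ} (hm : HasSum (fun n => a n * c n) m) (hs : HasSum (fun n => a n * c n ^ 2) s)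
    (hD : HasSum (fun n => a n * (c (n + 1) - c n) ^ 2) D) :
    s - m ^ 2 ≤ ν * D := by
  have hshift {f : ℕ → ℝ} {l : ℝ} (hf : HasSum f l) :
      Filter.Tendsto (fun N => ∑ n ∈ range (N + 1), f n) Filter.atTop (nhds l) :=
    hf.tendsto_sum_nat.comp (Filter.tendsto_add_atTop_nat 1)
  have hlim := ((hshift ha1).mul (hshift hs)).sub ((hshift hm).pow 2)
  rw [one_mul] at hlim
  exact le_of_tendsto_of_tendsto' hlim (hD.tendsto_sum_nat.const_mul ν)
    (poisson_poincare_truncated hν ha0 ha (fun N => sum_le_hasSum _ (fun n _ => ha0 n) ha1) c)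

end PoissonPoincare

section HarmonicCriterion

open Filter

variable {q t : ℕ → ℝ}

/- If `ε ≤ |q n|` eventually, then `t` dominates a multiple of the harmonic series. -/
lemma frequently_abs_lt_of_le_mul_summable (ht : Summable t)
    (hq : ∀ n : ℕ, |q n| ≤ ((n : ℝ) + 1) * t n) {ε : ℝ} (hε : 0 < ε) :
    ∃ᶠ n in atTop, |q n| < ε := by
  intro hcon
  simp only [not_lt] at hcon
  refine Real.not_summable_one_div_natCast
    ((summable_nat_add_iff (f := fun n : ℕ => 1 / (n : ℝ)) 1).1 ?_)
  refine (ht.mul_left ε⁻¹).of_norm_bounded_eventually_nat ?_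
  filter_upwards [hcon] with n hn
  have hn' : ε ≤ ((n : ℝ) + 1) * t n := hn.trans (hq n)
  rw [Nat.cast_succ, Real.norm_of_nonneg (by positivity), div_le_iff₀ (by positivity),
    mul_assoc, ← div_eq_inv_mul, le_div_iff₀ hε]
  linarith

lemma eq_zero_of_tendsto_of_le_mul_summable {l : ℝ} (ht : Summable t)
    (hq : ∀ n : ℕ, |q n| ≤ ((n : ℝ) + 1) * t n) (hl : Tendsto q atTop (nhds l)) : l = 0 := by
  refine abs_nonpos_iff.1 (le_of_forall_pos_le_add fun ε hε => ?_)
  rw [zero_add]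
  exact le_of_tendsto_of_frequently hl.abs
    ((frequently_abs_lt_of_le_mul_summable ht hq hε).mono fun _ => le_of_lt)

lemma hasSum_of_tendsto_sub_of_le_mul_summable {d : ℕ → ℝ} {l : ℝ} (hd : ∀ n, 0 ≤ d n)
    (ht : Summable t) (hq : ∀ n : ℕ, |q n| ≤ ((n : ℝ) + 1) * t n)
    (hl : Tendsto (fun N => ∑ n ∈ Finset.range N, d n - q N) atTop (nhds l)) : HasSum d l := by
  have hbound : ∀ N, ∑ n ∈ Finset.range N, d n ≤ l + 2 := by
    intro N
    obtain ⟨M, ⟨hM, hqM⟩, hNM⟩ := (((hl.eventually (gt_mem_nhds (lt_add_one l))).and_frequently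
      (frequently_abs_lt_of_le_mul_summable ht hq one_pos)).and_eventually
        (eventually_ge_atTop N)).exists
    have hmono := Finset.sum_le_sum_of_subset_of_nonneg (Finset.range_mono hNM)
      fun n _ _ => hd n
    linarith [(abs_lt.1 hqM).2]
  have hsum : HasSum d (∑' n, d n) := (summable_of_sum_range_le hd hbound).hasSum
  have hq0 := eq_zero_of_tendsto_of_le_mul_summable ht hq
    ((hsum.tendsto_sum_nat.sub hl).congr fun N => sub_sub_cancel _ _)
  rwa [sub_eq_zero.1 hq0] at hsum

end HarmonicCriterion

section InnerProductSpace

variable {E F : Type*} [NormedAddCommGroup E] [InnerProductSpace ℝ E] [NormedAddCommGroup F]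
  [InnerProductSpace ℝ F]

lemma isLinearMap_of_inner_eq {T : E → F} {S : F → E}
    (h : ∀ x y, inner ℝ (T x) y = inner ℝ x (S y)) : IsLinearMap ℝ T where
  map_add x y := ext_inner_right ℝ fun z => by simp only [inner_add_left, h]
  map_smul r x := ext_inner_right ℝ fun z => by simp only [real_inner_smul_left, h]

lemma norm_sub_smul_sq_of_inner_eq {z e : E} {d : ℝ} (h : inner ℝ z e = d * ‖e‖ ^ 2) :
    ‖z - d • e‖ ^ 2 = ‖z‖ ^ 2 - ‖e‖ ^ 2 * d ^ 2 := by
  rw [norm_sub_sq_real, real_inner_smul_right, h, norm_smul, mul_pow, Real.norm_eq_abs, sq_abs]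
  ring

lemma eq_zero_of_inner_self_eq_zero_of_nonpos {K : E → E}
    (hsymm : ∀ x y, inner ℝ (K x) y = inner ℝ x (K y)) (hneg : ∀ x, inner ℝ x (K x) ≤ 0) {x : E}
    (hx : inner ℝ x (K x) = 0) : K x = 0 := by
  let B : LinearMap.BilinForm ℝ E :=
    -(innerₗ E).compl₂ ((isLinearMap_of_inner_eq hsymm).mk' K)
  have hB (y z : E) : B y z = -inner ℝ y (K z) := rfl
  have hcs := B.apply_mul_apply_le_of_forall_zero_le (fun y => neg_nonneg.2 (hneg y)) x (K x)
  rw [hB, hB, hB, hx, ← hsymm x, neg_mul_neg, neg_zero, zero_mul] at hcs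
  exact inner_self_eq_zero.1 (mul_self_eq_zero.1 (le_antisymm hcs (mul_self_nonneg _)))

end InnerProductSpace

/-- The algebraic skeleton of the particle system: Hilbert spaces `E n` (the states of `n`
particles), creation and annihilation maps `raise` and `lower`, which are adjoint up to the factor
`ν = μ / ρ` and satisfy the canonical commutation relation, a symmetric nonpositive collision map
`coll` on every level, and the components `one n` of the ground state. The maps are linear because
they have adjoints, so linearity is not a field. -/
structure Ladder (E : ℕ → Type*) [∀ n, NormedAddCommGroup (E n)]
    [∀ n, InnerProductSpace ℝ (E n)] (ν : ℝ) where
  raise : ∀ n, E n → E (n + 1)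
  lower : ∀ n, E (n + 1) → E n
  coll : ∀ n, E n → E n
  one : ∀ n, E n
  pos : 0 < ν
  inner_raise : ∀ n x y, inner ℝ (raise n x) y = ν * inner ℝ x (lower n y)
  inner_coll : ∀ n x y, inner ℝ (coll n x) y = inner ℝ x (coll n y)
  inner_coll_self_nonpos : ∀ n x, inner ℝ x (coll n x) ≤ 0
  lower_raise_zero : ∀ x, lower 0 (raise 0 x) = x
  lower_raise_succ : ∀ n x, lower (n + 1) (raise (n + 1) x) = raise n (lower n x) + x
  raise_one : ∀ n, raise n (one n) = ((n : ℝ) + 1) • one (n + 1)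
  coll_one : ∀ n, coll n (one n) = 0
  eq_zero_of_inner_one_eq_zero : ∀ x : E 0, inner ℝ x (one 0) = 0 → x = 0

namespace Ladder

section Algebra

variable {E : ℕ → Type*} [∀ n, NormedAddCommGroup (E n)] [∀ n, InnerProductSpace ℝ (E n)]
  {ν : ℝ} (Λ : Ladder E ν)

lemma isLinearMap_raise (n : ℕ) : IsLinearMap ℝ (Λ.raise n) :=
  isLinearMap_of_inner_eq (S := fun y => ν • Λ.lower n y) fun x y => by
    rw [Λ.inner_raise, real_inner_smul_right]

lemma isLinearMap_lower (n : ℕ) : IsLinearMap ℝ (Λ.lower n) :=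
  isLinearMap_of_inner_eq (S := fun y => ν⁻¹ • Λ.raise n y) fun x y => by
    rw [real_inner_smul_right, real_inner_comm, real_inner_comm _ x, Λ.inner_raise,
      inv_mul_cancel_left₀ Λ.pos.ne']

lemma isLinearMap_coll (n : ℕ) : IsLinearMap ℝ (Λ.coll n) :=
  isLinearMap_of_inner_eq (Λ.inner_coll n)

lemma lower_one (n : ℕ) : Λ.lower n (Λ.one (n + 1)) = Λ.one n := by
  induction n with
  | zero =>
    simpa only [Λ.raise_one, Nat.cast_zero, zero_add, one_smul] using Λ.lower_raise_zero (Λ.one 0)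
  | succ n ih =>
    have h := Λ.lower_raise_succ n (Λ.one (n + 1))
    rw [ih, Λ.raise_one, Λ.raise_one, (Λ.isLinearMap_lower _).map_smul] at h
    refine smul_right_injective _ (by positivity : ((n + 1 : ℕ) : ℝ) + 1 ≠ 0) (h.trans ?_)
    simp only [add_smul, one_smul, Nat.cast_succ]

lemma succ_mul_norm_one_sq (n : ℕ) :
    ((n : ℝ) + 1) * ‖Λ.one (n + 1)‖ ^ 2 = ν * ‖Λ.one n‖ ^ 2 := by
  have h := Λ.inner_raise n (Λ.one n) (Λ.one (n + 1))
  rwa [Λ.raise_one, Λ.lower_one, real_inner_smul_left, real_inner_self_eq_norm_sq,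
    real_inner_self_eq_norm_sq] at h

lemma inner_coll_one (n : ℕ) (x : E n) : inner ℝ (Λ.coll n x) (Λ.one n) = 0 := by
  rw [Λ.inner_coll, Λ.coll_one, inner_zero_right]

lemma coll_zero (x : E 0) : Λ.coll 0 x = 0 :=
  Λ.eq_zero_of_inner_one_eq_zero _ (Λ.inner_coll_one 0 x)

lemma coll_eq_zero {n : ℕ} {x : E n} (hx : inner ℝ x (Λ.coll n x) = 0) : Λ.coll n x = 0 :=
  eq_zero_of_inner_self_eq_zero_of_nonpos (Λ.inner_coll n) (Λ.inner_coll_self_nonpos n) hx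

lemma mul_inner_lower_one (n : ℕ) (x : E (n + 1)) :
    ν * inner ℝ (Λ.lower n x) (Λ.one n) = ((n : ℝ) + 1) * inner ℝ x (Λ.one (n + 1)) := by
  rw [real_inner_comm, ← Λ.inner_raise, Λ.raise_one, real_inner_smul_left, real_inner_comm]

lemma inner_lower_one_eq_zero {n : ℕ} {x : E (n + 1)} (hx : inner ℝ x (Λ.one (n + 1)) = 0) :
    inner ℝ (Λ.lower n x) (Λ.one n) = 0 := by
  have h := Λ.mul_inner_lower_one n x
  rw [hx, mul_zero] at h
  exact (mul_eq_zero.1 h).resolve_left Λ.pos.ne'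

lemma inner_raise_lower (n : ℕ) (x : E (n + 1)) :
    inner ℝ (Λ.raise n (Λ.lower n x)) x = ν * ‖Λ.lower n x‖ ^ 2 := by
  rw [Λ.inner_raise, real_inner_self_eq_norm_sq]

lemma norm_raise_lower_zero_sq (x : E 1) :
    ‖Λ.raise 0 (Λ.lower 0 x)‖ ^ 2 = ν * ‖Λ.lower 0 x‖ ^ 2 := by
  rw [← real_inner_self_eq_norm_sq, Λ.inner_raise, Λ.lower_raise_zero, real_inner_self_eq_norm_sq]

lemma norm_raise_lower_succ_sq (n : ℕ) (x : E (n + 2)) :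
    ‖Λ.raise (n + 1) (Λ.lower (n + 1) x)‖ ^ 2 =
      ν * (ν * ‖Λ.lower n (Λ.lower (n + 1) x)‖ ^ 2) + ν * ‖Λ.lower (n + 1) x‖ ^ 2 := by
  rw [← real_inner_self_eq_norm_sq, Λ.inner_raise, Λ.lower_raise_succ, inner_add_right,
    real_inner_self_eq_norm_sq, real_inner_comm, inner_raise_lower, mul_add]

lemma mul_norm_lower_sq_le_of_norm_raise_lower_sq_le {n : ℕ} {x : E (n + 1)} {k : ℝ} (hk : 0 ≤ k)
    (h : ‖Λ.raise n (Λ.lower n x)‖ ^ 2 ≤ k * (ν * ‖Λ.lower n x‖ ^ 2)) :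
    ν * ‖Λ.lower n x‖ ^ 2 ≤ k * ‖x‖ ^ 2 := by
  set t := ν * ‖Λ.lower n x‖ ^ 2 with ht
  have ht0 : 0 ≤ t := mul_nonneg Λ.pos.le (sq_nonneg _)
  have h_cs : t ^ 2 ≤ ‖Λ.raise n (Λ.lower n x)‖ ^ 2 * ‖x‖ ^ 2 := by
    rw [ht, ← inner_raise_lower, ← mul_pow, ← sq_abs]
    exact pow_le_pow_left₀ (abs_nonneg _) (abs_real_inner_le_norm _ _) 2
  have ht2 : t ^ 2 ≤ k * t * ‖x‖ ^ 2 := h_cs.trans (mul_le_mul_of_nonneg_right h (sq_nonneg _))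
  rcases ht0.eq_or_lt with h0 | h0
  · rw [← h0]; positivity
  · exact le_of_mul_le_mul_left (by linarith) h0

lemma mul_norm_lower_sq_le (n : ℕ) (x : E (n + 1)) :
    ν * ‖Λ.lower n x‖ ^ 2 ≤ ((n : ℝ) + 1) * ‖x‖ ^ 2 := by
  refine Λ.mul_norm_lower_sq_le_of_norm_raise_lower_sq_le (by positivity) ?_
  induction n with
  | zero => rw [norm_raise_lower_zero_sq, Nat.cast_zero, zero_add, one_mul]
  | succ n ih =>
    have hlower := Λ.mul_norm_lower_sq_le_of_norm_raise_lower_sq_le (by positivity)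
      (ih (Λ.lower (n + 1) x))
    rw [norm_raise_lower_succ_sq, Nat.cast_succ]
    linarith [mul_le_mul_of_nonneg_left hlower Λ.pos.le]

lemma mul_norm_lower_sq_le_of_inner_one_eq_zero (n : ℕ) {x : E (n + 1)}
    (hx : inner ℝ x (Λ.one (n + 1)) = 0) : ν * ‖Λ.lower n x‖ ^ 2 ≤ n * ‖x‖ ^ 2 := by
  induction n with
  | zero => simp [Λ.eq_zero_of_inner_one_eq_zero _ (Λ.inner_lower_one_eq_zero hx)]
  | succ n ih =>
    refine Λ.mul_norm_lower_sq_le_of_norm_raise_lower_sq_le (by positivity) ?_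
    rw [norm_raise_lower_succ_sq, Nat.cast_succ]
    linarith [mul_le_mul_of_nonneg_left (ih (Λ.inner_lower_one_eq_zero hx)) Λ.pos.le]

/-- The coefficient of the orthogonal projection of `x` to the line through `one n`. -/
noncomputable def mean (n : ℕ) (x : E n) : ℝ := inner ℝ x (Λ.one n) / ‖Λ.one n‖ ^ 2

lemma inner_one_eq_mean_mul (n : ℕ) (x : E n) :
    inner ℝ x (Λ.one n) = Λ.mean n x * ‖Λ.one n‖ ^ 2 := by
  rcases eq_or_ne (Λ.one n) 0 with h | h
  · simp [h]
  · exact (div_mul_cancel₀ _ (pow_ne_zero 2 (norm_ne_zero_iff.2 h))).symm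

lemma norm_sub_mean_smul_one_sq (n : ℕ) (x : E n) :
    ‖x - Λ.mean n x • Λ.one n‖ ^ 2 = ‖x‖ ^ 2 - ‖Λ.one n‖ ^ 2 * Λ.mean n x ^ 2 :=
  norm_sub_smul_sq_of_inner_eq (Λ.inner_one_eq_mean_mul n x)

lemma inner_sub_mean_smul_one (n : ℕ) (x : E n) :
    inner ℝ (x - Λ.mean n x • Λ.one n) (Λ.one n) = 0 := by
  rw [inner_sub_left, real_inner_smul_left, real_inner_self_eq_norm_sq, inner_one_eq_mean_mul,
    sub_self]

lemma norm_one_sq_mul_mean_sq_le (n : ℕ) (x : E n) :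
    ‖Λ.one n‖ ^ 2 * Λ.mean n x ^ 2 ≤ ‖x‖ ^ 2 :=
  sub_nonneg.1 ((Λ.norm_sub_mean_smul_one_sq n x).symm ▸ sq_nonneg _)

lemma norm_sq_eq_of_level_zero (x : E 0) : ‖x‖ ^ 2 = ‖Λ.one 0‖ ^ 2 * Λ.mean 0 x ^ 2 := by
  rw [← sub_eq_zero, ← norm_sub_mean_smul_one_sq,
    Λ.eq_zero_of_inner_one_eq_zero _ (Λ.inner_sub_mean_smul_one 0 x), norm_zero,
    zero_pow two_ne_zero]

lemma inner_lower_one_eq_mean_mul (n : ℕ) (x : E (n + 1)) :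
    inner ℝ (Λ.lower n x) (Λ.one n) = Λ.mean (n + 1) x * ‖Λ.one n‖ ^ 2 := by
  refine mul_left_cancel₀ Λ.pos.ne' ?_
  rw [mul_inner_lower_one, inner_one_eq_mean_mul]
  linear_combination Λ.mean (n + 1) x * Λ.succ_mul_norm_one_sq n

lemma norm_one_sq_mul_mean_sub_sq_le (n : ℕ) (x : E n) (y : E (n + 1)) :
    ‖Λ.one n‖ ^ 2 * (Λ.mean (n + 1) y - Λ.mean n x) ^ 2 ≤ ‖Λ.lower n y - x‖ ^ 2 := by
  refine sub_nonneg.1 (le_of_le_of_eq (sq_nonneg _) (norm_sub_smul_sq_of_inner_eq ?_))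
  rw [inner_sub_left, inner_lower_one_eq_mean_mul, inner_one_eq_mean_mul, sub_mul]

lemma norm_sq_sub_mean_sq_le (n : ℕ) (x : E (n + 1)) :
    ‖x‖ ^ 2 - ‖Λ.one (n + 1)‖ ^ 2 * Λ.mean (n + 1) x ^ 2 ≤
      ((n : ℝ) + 1) * ‖x‖ ^ 2 - ν * ‖Λ.lower n x‖ ^ 2 := by
  have hx := Λ.norm_sub_mean_smul_one_sq (n + 1) x
  have hlower := norm_sub_smul_sq_of_inner_eq (Λ.inner_lower_one_eq_mean_mul n x)
  have hbound := Λ.mul_norm_lower_sq_le_of_inner_one_eq_zero n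
    (Λ.inner_sub_mean_smul_one (n + 1) x)
  rw [(Λ.isLinearMap_lower n).map_sub, (Λ.isLinearMap_lower n).map_smul, lower_one, hx,
    hlower] at hbound
  linear_combination hbound - Λ.mean (n + 1) x ^ 2 * Λ.succ_mul_norm_one_sq n

/-- The expression `ρ (P⁺ - 𝒩) + μ (P⁻ - 1) + lam K` with `μ = ρ ν`, computed level by level. -/
def gen (ρ lam : ℝ) (h : ∀ n, E n) : ∀ n, E n
  | 0 => (ρ * ν) • (Λ.lower 0 (h 1) - h 0) + lam • Λ.coll 0 (h 0)
  | n + 1 => ρ • (Λ.raise n (h n) - ((n : ℝ) + 1) • h (n + 1)) +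
      (ρ * ν) • (Λ.lower (n + 1) (h (n + 2)) - h (n + 1)) + lam • Λ.coll (n + 1) (h (n + 1))

/-- The contribution of the levels `n` and `n + 1` to the energy `-(h, gen h)`. -/
def dissipation (ρ lam : ℝ) (h : ∀ n, E n) (n : ℕ) : ℝ :=
  ρ * ν * ‖Λ.lower n (h (n + 1)) - h n‖ ^ 2 +
    ρ * (((n : ℝ) + 1) * ‖h (n + 1)‖ ^ 2 - ν * ‖Λ.lower n (h (n + 1))‖ ^ 2) -
    lam * inner ℝ (h (n + 1)) (Λ.coll (n + 1) (h (n + 1)))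

variable {ρ lam : ℝ}

lemma gen_eq_zero {h : ∀ n, E n} {m : ℕ} (hm : ∀ n, m < n → h n = 0) {n : ℕ} (hn : m + 1 < n) :
    Λ.gen ρ lam h n = 0 := by
  obtain ⟨n, rfl⟩ : ∃ k, n = k + 1 := ⟨n - 1, by omega⟩
  simp only [gen, hm n (by omega), hm (n + 1) (by omega), hm (n + 2) (by omega),
    (Λ.isLinearMap_raise _).map_zero, (Λ.isLinearMap_lower _).map_zero,
    (Λ.isLinearMap_coll _).map_zero, smul_zero, sub_zero, add_zero]

lemma sum_inner_gen_sub (h g : ∀ n, E n) (N : ℕ) :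
    ∑ n ∈ Finset.range (N + 1),
      (inner ℝ (Λ.gen ρ lam h n) (g n) - inner ℝ (h n) (Λ.gen ρ lam g n)) =
    ρ * (ν * inner ℝ (g N) (Λ.lower N (h (N + 1))) -
      ν * inner ℝ (h N) (Λ.lower N (g (N + 1)))) := by
  induction N with
  | zero =>
    simp only [zero_add, Finset.sum_range_one, gen, coll_zero, smul_zero, add_zero,
      inner_sub_left, inner_sub_right, real_inner_smul_left, real_inner_smul_right]
    rw [real_inner_comm (g 0)]
    ring
  | succ N ih =>
    rw [Finset.sum_range_succ, ih]
    simp only [gen, inner_add_left, inner_add_right, inner_sub_left, inner_sub_right,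
      real_inner_smul_left, real_inner_smul_right, Λ.inner_coll]
    rw [Λ.inner_raise, real_inner_comm (Λ.raise N (g N)), Λ.inner_raise,
      real_inner_comm (g (N + 1)) (Λ.lower (N + 1) _)]
    ring

lemma sum_inner_gen (h : ∀ n, E n) (N : ℕ) :
    ∑ n ∈ Finset.range (N + 1), inner ℝ (h n) (Λ.gen ρ lam h n) =
      ρ * (ν * inner ℝ (h N) (Λ.lower N (h (N + 1))) - ν * ‖h N‖ ^ 2) -
        ∑ n ∈ Finset.range N, Λ.dissipation ρ lam h n := by
  induction N with
  | zero =>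
    simp only [zero_add, Finset.sum_range_one, gen, coll_zero, smul_zero, add_zero,
      inner_sub_right, real_inner_smul_right, real_inner_self_eq_norm_sq, Finset.sum_range_zero]
    ring
  | succ N ih =>
    rw [Finset.sum_range_succ, ih, Finset.sum_range_succ]
    simp only [gen, dissipation, inner_add_right, inner_sub_right, real_inner_smul_right,
      real_inner_self_eq_norm_sq]
    rw [real_inner_comm (Λ.raise N (h N)), Λ.inner_raise, norm_sub_sq_real,
      real_inner_comm _ (h N)]
    ring

lemma abs_mul_inner_lower_le (n : ℕ) (x : E n) (y : E (n + 1)) :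
    |ν * inner ℝ x (Λ.lower n y)| ≤ ((n : ℝ) + 1) * (ν * ‖x‖ ^ 2 + ‖y‖ ^ 2) := by
  have hν := Λ.pos
  rw [abs_mul, abs_of_pos hν]
  calc ν * |inner ℝ x (Λ.lower n y)|
      ≤ ν * (‖x‖ * ‖Λ.lower n y‖) := by gcongr; exact abs_real_inner_le_norm _ _
    _ ≤ ν * (‖x‖ ^ 2 + ‖Λ.lower n y‖ ^ 2) := by
        gcongr
        nlinarith [sq_nonneg (‖x‖ - ‖Λ.lower n y‖), sq_nonneg ‖x‖, sq_nonneg ‖Λ.lower n y‖]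
    _ = ν * ‖x‖ ^ 2 + ν * ‖Λ.lower n y‖ ^ 2 := mul_add _ _ _
    _ ≤ ((n : ℝ) + 1) * (ν * ‖x‖ ^ 2) + ((n : ℝ) + 1) * ‖y‖ ^ 2 := by
        refine add_le_add (le_mul_of_one_le_left (by positivity) ?_) (Λ.mul_norm_lower_sq_le n y)
        exact le_add_of_nonneg_left n.cast_nonneg
    _ = _ := (mul_add _ _ _).symm

lemma gen_smul_one (c : ℕ → ℝ) (n : ℕ) :
    Λ.gen ρ lam (fun n => c n • Λ.one n) n =
      (ρ * (n * (c (n - 1) - c n)) + ρ * ν * (c (n + 1) - c n)) • Λ.one n := by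
  cases n <;>
  · simp only [gen, (Λ.isLinearMap_lower _).map_smul, lower_one, (Λ.isLinearMap_coll _).map_smul,
      Λ.coll_one, (Λ.isLinearMap_raise _).map_smul, Λ.raise_one, Nat.add_sub_cancel]
    module

lemma gen_one (n : ℕ) : Λ.gen ρ lam Λ.one n = 0 := by
  simpa using Λ.gen_smul_one (ρ := ρ) (lam := lam) (fun _ => 1) n

lemma gen_affine_smul_one {b d : ℝ} (hbd : ν * b = d) (n : ℕ) :
    Λ.gen ρ lam (fun n => (b * (n : ℝ) - d) • Λ.one n) n =
      (-ρ) • ((b * (n : ℝ) - d) • Λ.one n) := by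
  rw [gen_smul_one, smul_smul]
  congr 1
  cases n with
  | zero =>
    push_cast
    linear_combination ρ * hbd
  | succ n =>
    simp only [Nat.add_sub_cancel]
    push_cast
    linear_combination ρ * hbd

lemma inner_gen_zero_one (h : ∀ n, E n) :
    inner ℝ (Λ.gen ρ lam h 0) (Λ.one 0) =
      ρ * (inner ℝ (h 1) (Λ.one 1) - ν * inner ℝ (h 0) (Λ.one 0)) := by
  have hlower := Λ.mul_inner_lower_one 0 (h 1)
  simp only [gen, inner_add_left, inner_sub_left, real_inner_smul_left, inner_coll_one]
  push_cast at hlower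
  linear_combination ρ * hlower

lemma inner_gen_succ_one (h : ∀ n, E n) (n : ℕ) :
    inner ℝ (Λ.gen ρ lam h (n + 1)) (Λ.one (n + 1)) =
      ρ * (ν * inner ℝ (h n) (Λ.one n) - ((n : ℝ) + 1) * inner ℝ (h (n + 1)) (Λ.one (n + 1)) +
        (((n : ℝ) + 2) * inner ℝ (h (n + 2)) (Λ.one (n + 2)) -
          ν * inner ℝ (h (n + 1)) (Λ.one (n + 1)))) := by
  have hlower := Λ.mul_inner_lower_one (n + 1) (h (n + 2))
  simp only [gen, inner_add_left, inner_sub_left, real_inner_smul_left, inner_coll_one,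
    Λ.inner_raise, lower_one]
  push_cast at hlower
  linear_combination ρ * hlower

lemma inner_one_eq_zero_of_gen_eq_neg_smul (hρ : ρ ≠ 0) {g : ∀ n, E n}
    (hg : ∀ n, Λ.gen ρ lam g n = (-ρ) • g n) (h0 : inner ℝ (g 0) (Λ.one 0) = 0) (n : ℕ) :
    inner ℝ (g n) (Λ.one n) = 0 := by
  have h1 : inner ℝ (g 1) (Λ.one 1) = 0 := by
    have h := Λ.inner_gen_zero_one (ρ := ρ) (lam := lam) g
    rw [hg, real_inner_smul_left, h0, mul_zero, mul_zero, sub_zero] at h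
    exact (mul_eq_zero.1 h.symm).resolve_left hρ
  suffices h : inner ℝ (g n) (Λ.one n) = 0 ∧ inner ℝ (g (n + 1)) (Λ.one (n + 1)) = 0 from h.1
  induction n with
  | zero => exact ⟨h0, h1⟩
  | succ n ih =>
    refine ⟨ih.2, ?_⟩
    have h := Λ.inner_gen_succ_one (ρ := ρ) (lam := lam) g n
    rw [hg, real_inner_smul_left, ih.1, ih.2] at h
    have hmul : (ρ * ((n : ℝ) + 2)) * inner ℝ (g (n + 2)) (Λ.one (n + 2)) = 0 := by
      linear_combination -h
    exact (mul_eq_zero.1 hmul).resolve_left (mul_ne_zero hρ (by positivity))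

section Dissipation

variable (h : ∀ n, E n) (n : ℕ)

lemma neg_mul_inner_coll_nonneg (hlam : 0 ≤ lam) (x : E n) :
    0 ≤ -(lam * inner ℝ x (Λ.coll n x)) :=
  neg_nonneg.2 (mul_nonpos_of_nonneg_of_nonpos hlam (Λ.inner_coll_self_nonpos n x))

lemma dissipation_nonneg (hρ : 0 ≤ ρ) (hlam : 0 ≤ lam) : 0 ≤ Λ.dissipation ρ lam h n := by
  have hcoll := Λ.neg_mul_inner_coll_nonneg (n + 1) hlam (h (n + 1))
  have hlower := mul_nonneg hρ (sub_nonneg.2 (Λ.mul_norm_lower_sq_le n (h (n + 1))))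
  have hsq := mul_nonneg (mul_nonneg hρ Λ.pos.le) (sq_nonneg ‖Λ.lower n (h (n + 1)) - h n‖)
  rw [dissipation]
  linarith

lemma mean_sub_sq_add_le_dissipation (hρ : 0 ≤ ρ) (hlam : 0 ≤ lam) :
    ρ * (ν * (‖Λ.one n‖ ^ 2 * (Λ.mean (n + 1) (h (n + 1)) - Λ.mean n (h n)) ^ 2) +
        (‖h (n + 1)‖ ^ 2 - ‖Λ.one (n + 1)‖ ^ 2 * Λ.mean (n + 1) (h (n + 1)) ^ 2)) ≤
      Λ.dissipation ρ lam h n := by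
  have hcoll := Λ.neg_mul_inner_coll_nonneg (n + 1) hlam (h (n + 1))
  have hmean := mul_le_mul_of_nonneg_left
    (Λ.norm_one_sq_mul_mean_sub_sq_le n (h n) (h (n + 1))) (mul_nonneg hρ Λ.pos.le)
  have hvar := mul_le_mul_of_nonneg_left (Λ.norm_sq_sub_mean_sq_le n (h (n + 1))) hρ
  rw [dissipation]
  linarith

variable {h n}

lemma norm_sq_add_le_dissipation (hρ : 0 ≤ ρ) (hn : inner ℝ (h (n + 1)) (Λ.one (n + 1)) = 0) :
    ρ * ν * ‖Λ.lower n (h (n + 1)) - h n‖ ^ 2 + ρ * ‖h (n + 1)‖ ^ 2 -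
      lam * inner ℝ (h (n + 1)) (Λ.coll (n + 1) (h (n + 1))) ≤ Λ.dissipation ρ lam h n := by
  have hlower := mul_le_mul_of_nonneg_left (Λ.mul_norm_lower_sq_le_of_inner_one_eq_zero n hn) hρ
  rw [dissipation]
  linarith

lemma mul_norm_sq_le_dissipation (hρ : 0 ≤ ρ) (hlam : 0 ≤ lam)
    (hn : inner ℝ (h (n + 1)) (Λ.one (n + 1)) = 0) :
    ρ * ‖h (n + 1)‖ ^ 2 ≤ Λ.dissipation ρ lam h n := by
  have hcoll := Λ.neg_mul_inner_coll_nonneg (n + 1) hlam (h (n + 1))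
  have hsq := mul_nonneg (mul_nonneg hρ Λ.pos.le) (sq_nonneg ‖Λ.lower n (h (n + 1)) - h n‖)
  linarith [Λ.norm_sq_add_le_dissipation (lam := lam) hρ hn]

lemma lower_eq_of_dissipation_eq (hρ : 0 < ρ) (hlam : 0 ≤ lam)
    (hn : inner ℝ (h (n + 1)) (Λ.one (n + 1)) = 0)
    (hd : Λ.dissipation ρ lam h n = ρ * ‖h (n + 1)‖ ^ 2) : Λ.lower n (h (n + 1)) = h n := by
  have hcoll := Λ.neg_mul_inner_coll_nonneg (n + 1) hlam (h (n + 1))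
  have hle := Λ.norm_sq_add_le_dissipation (lam := lam) hρ.le hn
  have hsq : ‖Λ.lower n (h (n + 1)) - h n‖ ^ 2 ≤ 0 :=
    nonpos_of_mul_nonpos_right (by linarith) (mul_pos hρ Λ.pos)
  exact sub_eq_zero.1 (norm_eq_zero.1 (pow_eq_zero_iff two_ne_zero |>.1
    (le_antisymm hsq (sq_nonneg _))))

lemma coll_eq_zero_of_dissipation_eq (hρ : 0 ≤ ρ) (hlam : 0 < lam)
    (hn : inner ℝ (h (n + 1)) (Λ.one (n + 1)) = 0)
    (hd : Λ.dissipation ρ lam h n = ρ * ‖h (n + 1)‖ ^ 2) :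
    Λ.coll (n + 1) (h (n + 1)) = 0 := by
  have hsq := mul_nonneg (mul_nonneg hρ Λ.pos.le) (sq_nonneg ‖Λ.lower n (h (n + 1)) - h n‖)
  have hle := Λ.norm_sq_add_le_dissipation (lam := lam) hρ hn
  refine Λ.coll_eq_zero (le_antisymm (Λ.inner_coll_self_nonpos _ _) ?_)
  exact nonneg_of_mul_nonneg_right (by linarith) hlam

end Dissipation

/-- Sequences annihilated by `coll` and compatible with `raise` and `lower`. They are the
eigenvectors of `gen` for `-ρ` that are orthogonal to the ground state on every level. -/
structure IsCoherent (x : ∀ n, E n) : Prop where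
  zero : x 0 = 0
  raise : ∀ n, Λ.raise n (x n) = (n : ℝ) • x (n + 1)
  lower : ∀ n, Λ.lower n (x (n + 1)) = x n
  coll : ∀ n, Λ.coll n (x n) = 0

namespace IsCoherent

variable {Λ}

lemma smul {x : ∀ n, E n} (hx : Λ.IsCoherent x) (c : ℝ) : Λ.IsCoherent fun n => c • x n where
  zero := by rw [hx.zero, smul_zero]
  raise n := by rw [(Λ.isLinearMap_raise n).map_smul, hx.raise, smul_comm]
  lower n := by rw [(Λ.isLinearMap_lower n).map_smul, hx.lower]
  coll n := by rw [(Λ.isLinearMap_coll n).map_smul, hx.coll, smul_zero]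

lemma gen_eq {x : ∀ n, E n} (hx : Λ.IsCoherent x) (n : ℕ) :
    Λ.gen ρ lam x n = (-ρ) • x n := by
  cases n with
  | zero =>
    rw [gen, hx.lower, hx.coll, hx.zero, sub_zero, smul_zero, smul_zero, smul_zero, add_zero]
  | succ n =>
    rw [gen, hx.raise, hx.lower, hx.coll]
    module

lemma eq_smul {x y : ∀ n, E n} (hx : Λ.IsCoherent x) (hy : Λ.IsCoherent y) {s : ℝ}
    (h1 : y 1 = s • x 1) (n : ℕ) : y n = s • x n := by
  induction n with
  | zero => rw [hy.zero, hx.zero, smul_zero]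
  | succ n ih =>
    rcases n.eq_zero_or_pos with rfl | hn
    · exact h1
    · refine smul_right_injective _ (Nat.cast_ne_zero.2 hn.ne' : (n : ℝ) ≠ 0) ?_
      change (n : ℝ) • y (n + 1) = (n : ℝ) • s • x (n + 1)
      rw [← hy.raise, ih, (Λ.isLinearMap_raise n).map_smul, hx.raise, smul_comm]

end IsCoherent

end Algebra

end Ladder

lemma hasSum_norm_sq {E : ℕ → Type*} [∀ n, NormedAddCommGroup (E n)]
    [∀ n, InnerProductSpace ℝ (E n)] (h : lp E 2) : HasSum (fun n => ‖h n‖ ^ 2) (‖h‖ ^ 2) := by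
  simpa only [real_inner_self_eq_norm_sq] using lp.hasSum_inner (𝕜 := ℝ) h h

namespace Ladder

open Filter

variable {E : ℕ → Type*} [∀ n, NormedAddCommGroup (E n)] [∀ n, InnerProductSpace ℝ (E n)]

lemma summable_mul_norm_sq_add_norm_succ_sq (ν : ℝ) (g h : lp E 2) :
    Summable fun n => ν * ‖g n‖ ^ 2 + ‖h (n + 1)‖ ^ 2 :=
  ((hasSum_norm_sq g).summable.mul_left ν).add
    ((summable_nat_add_iff (f := fun n => ‖h n‖ ^ 2) 1).2 (hasSum_norm_sq h).summable)

/-- `A` is the operator that acts by `Λ.gen` on every level, on its maximal domain. -/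
structure IsMaximal {ν : ℝ} (Λ : Ladder E ν) (ρ lam : ℝ) (A : lp E 2 →ₗ.[ℝ] lp E 2) : Prop where
  mem_domain : ∀ h g : lp E 2, (∀ n, g n = Λ.gen ρ lam h n) → h ∈ A.domain
  apply : ∀ (h : A.domain) (n : ℕ), A h n = Λ.gen ρ lam (h : lp E 2) n

namespace IsMaximal

variable {ν : ℝ} {Λ : Ladder E ν} {ρ lam : ℝ} {A : lp E 2 →ₗ.[ℝ] lp E 2}

section SelfAdjoint

lemma gen_single_eq_zero {m n : ℕ} (x : E m) (hn : m + 1 < n) :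
    Λ.gen ρ lam (lp.single 2 m x) n = 0 :=
  Λ.gen_eq_zero (fun _ hk => lp.single_apply_ne _ _ _ hk.ne') hn

lemma single_mem (hA : Λ.IsMaximal ρ lam A) (m : ℕ) (x : E m) : lp.single 2 m x ∈ A.domain := by
  have hfin : Memℓp (Λ.gen ρ lam (lp.single 2 m x)) 2 := by
    refine (memℓp_zero ((Set.finite_Iic (m + 1)).subset fun n hn => ?_)).of_exponent_ge zero_le
    by_contra hmn
    exact hn (gen_single_eq_zero x (not_le.1 hmn))
  exact hA.mem_domain _ ⟨_, hfin⟩ fun n => rfl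

lemma dense_domain (hA : Λ.IsMaximal ρ lam A) : Dense (A.domain : Set (lp E 2)) := fun f =>
  mem_closure_of_tendsto (lp.hasSum_single (p := 2) (by norm_num) f)
    (Eventually.of_forall fun _ => A.domain.sum_mem fun i _ => hA.single_mem i (f i))

lemma hasSum_inner_gen_sub (hA : Λ.IsMaximal ρ lam A) (x y : A.domain) :
    HasSum (fun n => inner ℝ (Λ.gen ρ lam (x : lp E 2) n) ((y : lp E 2) n) -
      inner ℝ ((x : lp E 2) n) (Λ.gen ρ lam (y : lp E 2) n))
      (inner ℝ (A x) (y : lp E 2) - inner ℝ (x : lp E 2) (A y)) := by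
  simpa only [hA.apply] using
    (lp.hasSum_inner (𝕜 := ℝ) (A x) y).sub (lp.hasSum_inner (𝕜 := ℝ) (x : lp E 2) (A y))

-- The boundary term of Green's formula is at most `n + 1` times a summable sequence, so its limit
-- vanishes because the harmonic series diverges.
lemma isFormalAdjoint (hA : Λ.IsMaximal ρ lam A) : A.IsFormalAdjoint A := by
  intro x y
  have hlim := (hA.hasSum_inner_gen_sub x y).tendsto_sum_nat.comp (tendsto_add_atTop_nat 1)
  simp only [Function.comp_def, Λ.sum_inner_gen_sub] at hlim
  refine sub_eq_zero.1 (eq_zero_of_tendsto_of_le_mul_summable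
    (((summable_mul_norm_sq_add_norm_succ_sq ν (y : lp E 2) x).add
      (summable_mul_norm_sq_add_norm_succ_sq ν (x : lp E 2) y)).mul_left |ρ|) (fun N => ?_) hlim)
  rw [abs_mul, mul_left_comm, mul_add]
  exact mul_le_mul_of_nonneg_left ((abs_sub _ _).trans
    (add_le_add (Λ.abs_mul_inner_lower_le N _ _) (Λ.abs_mul_inner_lower_le N _ _))) (abs_nonneg ρ)

lemma inner_apply_single (hA : Λ.IsMaximal ρ lam A) (g : lp E 2) (m : ℕ) (x : E m) :
    inner ℝ (A ⟨_, hA.single_mem m x⟩) g = inner ℝ x (Λ.gen ρ lam g m) := by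
  set h : lp E 2 := lp.single 2 m x with hh
  have h_ne {k : ℕ} (hk : k ≠ m) : h k = 0 := lp.single_apply_ne _ _ _ hk
  have hleft : HasSum (fun n => inner ℝ (Λ.gen ρ lam h n) (g n))
      (inner ℝ (A ⟨_, hA.single_mem m x⟩) g) := by
    simpa only [hA.apply] using lp.hasSum_inner (𝕜 := ℝ) (A ⟨_, hA.single_mem m x⟩) g
  have hright : HasSum (fun n => inner ℝ (h n) (Λ.gen ρ lam g n))
      (inner ℝ x (Λ.gen ρ lam g m)) := by
    convert hasSum_single m fun n hn => ?_ using 1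
    · rw [hh, lp.single_apply_self]
    · rw [h_ne hn, inner_zero_left]
  refine sub_eq_zero.1 (tendsto_nhds_unique
    ((hleft.sub hright).tendsto_sum_nat.comp (tendsto_add_atTop_nat 1)) ?_)
  simp only [Function.comp_def, Λ.sum_inner_gen_sub]
  refine tendsto_const_nhds.congr' ((eventually_gt_atTop m).mono fun N hN => ?_)
  beta_reduce
  rw [h_ne (by omega), h_ne (by omega : N ≠ m), (Λ.isLinearMap_lower N).map_zero, inner_zero_right,
    inner_zero_left, mul_zero, sub_zero, mul_zero]

lemma isSelfAdjoint [∀ n, CompleteSpace (E n)] (hA : Λ.IsMaximal ρ lam A) : IsSelfAdjoint A := by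
  have hdense := hA.dense_domain
  have hgen (y : A.adjoint.domain) (m : ℕ) :
      A.adjoint y m = Λ.gen ρ lam (y : lp E 2) m := by
    refine ext_inner_left ℝ fun x => ?_
    rw [← hA.inner_apply_single, real_inner_comm, ← lp.inner_single_right,
      LinearPMap.adjoint_isFormalAdjoint hdense y ⟨_, hA.single_mem m x⟩, real_inner_comm]
  rw [LinearPMap.isSelfAdjoint_def]
  refine le_antisymm ?_ (hA.isFormalAdjoint.le_adjoint hdense)
  refine ⟨fun y hy => hA.mem_domain y (A.adjoint ⟨y, hy⟩) (hgen ⟨y, hy⟩),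
    fun y z hyz => lp.ext (funext fun m => ?_)⟩
  rw [hgen, hA.apply, hyz]

end SelfAdjoint

section Gap

lemma hasSum_dissipation (hA : Λ.IsMaximal ρ lam A) (hρ : 0 ≤ ρ) (hlam : 0 ≤ lam)
    (h : A.domain) :
    HasSum (Λ.dissipation ρ lam (h : lp E 2)) (-inner ℝ (h : lp E 2) (A h)) := by
  set g : lp E 2 := h.1 with hg
  have hlim := (lp.hasSum_inner (𝕜 := ℝ) g (A h)).tendsto_sum_nat.comp (tendsto_add_atTop_nat 1)
  simp only [Function.comp_def, hA.apply, ← hg, Λ.sum_inner_gen] at hlim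
  refine hasSum_of_tendsto_sub_of_le_mul_summable (Λ.dissipation_nonneg g · hρ hlam)
    (q := fun N => ρ * (ν * inner ℝ (g N) (Λ.lower N (g (N + 1))) - ν * ‖g N‖ ^ 2))
    (((summable_mul_norm_sq_add_norm_succ_sq ν g g).add
      ((hasSum_norm_sq g).summable.mul_left ν)).mul_left |ρ|) (fun N => ?_)
    (hlim.neg.congr fun N => neg_sub _ _)
  have hνN : 0 ≤ ν * ‖g N‖ ^ 2 := mul_nonneg Λ.pos.le (sq_nonneg _)
  rw [abs_mul, mul_left_comm, mul_add]
  refine mul_le_mul_of_nonneg_left ((abs_sub _ _).trans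
    (add_le_add (Λ.abs_mul_inner_lower_le N _ _) ?_)) (abs_nonneg ρ)
  rw [abs_of_nonneg hνN]
  exact le_mul_of_one_le_left hνN (le_add_of_nonneg_left N.cast_nonneg)

variable {e : lp E 2}

lemma hasSum_norm_one_sq (he : ∀ n, e n = Λ.one n) (hnorm : ‖e‖ = 1) :
    HasSum (fun n => ‖Λ.one n‖ ^ 2) 1 := by
  simpa only [he, hnorm, one_pow] using hasSum_norm_sq e

lemma hasSum_norm_one_sq_mul_mean (he : ∀ n, e n = Λ.one n) (g : lp E 2) :
    HasSum (fun n => ‖Λ.one n‖ ^ 2 * Λ.mean n (g n)) (inner ℝ g e) := by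
  simpa only [he, inner_one_eq_mean_mul, mul_comm] using lp.hasSum_inner (𝕜 := ℝ) g e

lemma summable_norm_one_sq_mul_mean_sq (Λ : Ladder E ν) (g : lp E 2) :
    Summable fun n => ‖Λ.one n‖ ^ 2 * Λ.mean n (g n) ^ 2 :=
  (hasSum_norm_sq g).summable.of_nonneg_of_le (fun _ => by positivity)
    fun n => Λ.norm_one_sq_mul_mean_sq_le n (g n)

lemma mul_norm_sq_sub_inner_sq_le (hA : Λ.IsMaximal ρ lam A) (hρ : 0 < ρ) (hlam : 0 ≤ lam)
    (he : ∀ n, e n = Λ.one n) (hnorm : ‖e‖ = 1) (h : A.domain) :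
    ρ * (‖(h : lp E 2)‖ ^ 2 - inner ℝ (h : lp E 2) e ^ 2) ≤ -inner ℝ (h : lp E 2) (A h) := by
  set g : lp E 2 := h.1
  set s := ∑' n, ‖Λ.one n‖ ^ 2 * Λ.mean n (g n) ^ 2
  set d : ℕ → ℝ := fun n => ‖Λ.one n‖ ^ 2 * (Λ.mean (n + 1) (g (n + 1)) - Λ.mean n (g n)) ^ 2
  have hs := (summable_norm_one_sq_mul_mean_sq Λ g).hasSum
  have hvar : HasSum (fun n => ‖g (n + 1)‖ ^ 2 -
      ‖Λ.one (n + 1)‖ ^ 2 * Λ.mean (n + 1) (g (n + 1)) ^ 2) (‖g‖ ^ 2 - s) := by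
    simpa [Λ.norm_sq_eq_of_level_zero (g 0)] using
      (hasSum_nat_add_iff' 1).2 ((hasSum_norm_sq g).sub hs)
  have hdiss := hA.hasSum_dissipation hρ.le hlam h
  have hle (n : ℕ) := Λ.mean_sub_sq_add_le_dissipation (lam := lam) g n hρ.le hlam
  have hd : Summable d := by
    refine (summable_mul_left_iff (mul_pos hρ Λ.pos).ne').1
      ((hdiss.sub (hvar.mul_left ρ)).summable.of_nonneg_of_le (fun n => ?_) fun n => ?_)
    · exact mul_nonneg (mul_pos hρ Λ.pos).le (by positivity)
    · linarith [hle n]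
  have hsum := hasSum_le hle (((hd.hasSum.mul_left ν).add hvar).mul_left ρ) hdiss
  have hpoincare := poisson_poincare Λ.pos.le (fun n => sq_nonneg _) Λ.succ_mul_norm_one_sq
    (hasSum_norm_one_sq he hnorm) (hasSum_norm_one_sq_mul_mean he g) hs hd.hasSum
  refine le_trans (mul_le_mul_of_nonneg_left ?_ hρ.le) hsum
  linarith

lemma inner_apply_nonpos (hA : Λ.IsMaximal ρ lam A) (hρ : 0 ≤ ρ) (hlam : 0 ≤ lam)
    (h : A.domain) : inner ℝ (h : lp E 2) (A h) ≤ 0 :=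
  neg_nonneg.1 ((hA.hasSum_dissipation hρ hlam h).nonneg (Λ.dissipation_nonneg _ · hρ hlam))

lemma mem_eigenspace_iff (hA : Λ.IsMaximal ρ lam A) {c : ℝ} {h : lp E 2} :
    h ∈ eigenspace A c ↔ ∀ n, Λ.gen ρ lam h n = c • h n := by
  refine ⟨fun ⟨hh, hAh⟩ n => ?_, fun hgen => ?_⟩
  · rw [← hA.apply ⟨h, hh⟩, hAh, lp.coeFn_smul, Pi.smul_apply]
  · have hh := hA.mem_domain h (c • h) fun n => (hgen n).symm
    exact ⟨hh, lp.ext (funext fun n => (hA.apply ⟨h, hh⟩ n).trans (hgen n))⟩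

lemma mem_eigenspace_of_eq_affine_smul_one (hA : Λ.IsMaximal ρ lam A) {b d : ℝ} (hbd : ν * b = d)
    {x : lp E 2} (hx : ∀ n, x n = (b * n - d) • Λ.one n) : x ∈ eigenspace A (-ρ) := by
  refine hA.mem_eigenspace_iff.2 fun n => ?_
  rw [show (x : ∀ n, E n) = fun n : ℕ => (b * n - d) • Λ.one n from funext hx]
  exact Λ.gen_affine_smul_one hbd n

lemma inner_eq_zero_of_mem_eigenspace (hA : Λ.IsMaximal ρ lam A) {b c : ℝ} (hbc : b ≠ c)
    {x y : lp E 2} (hx : x ∈ eigenspace A b) (hy : y ∈ eigenspace A c) : inner ℝ x y = 0 := by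
  obtain ⟨hxA, hx⟩ := hx
  obtain ⟨hyA, hy⟩ := hy
  have h := hA.isFormalAdjoint ⟨x, hxA⟩ ⟨y, hyA⟩
  rw [hx, hy, real_inner_smul_left, real_inner_smul_right] at h
  exact (mul_eq_mul_right_iff.1 h).resolve_left hbc

lemma isGreatest_rayleighValues (hA : Λ.IsMaximal ρ lam A) (hρ : 0 < ρ) (hlam : 0 ≤ lam)
    (he : ∀ n, e n = Λ.one n) (hnorm : ‖e‖ = 1) {x : lp E 2} (hx : x ∈ eigenspace A (-ρ))
    (hne : x ≠ 0) : IsGreatest (rayleighValues A (Submodule.span ℝ {e})) (-ρ) := by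
  have he0 : e ∈ eigenspace A 0 := hA.mem_eigenspace_iff.2 fun n => by
    rw [show (e : ∀ n, E n) = Λ.one from funext he, gen_one, zero_smul]
  have horth := hA.inner_eq_zero_of_mem_eigenspace (neg_ne_zero.2 hρ.ne').symm he0 hx
  have hunit : ‖‖x‖⁻¹ • x‖ = 1 := by
    rw [norm_smul, norm_inv, norm_norm, inv_mul_cancel₀ (norm_ne_zero_iff.2 hne)]
  constructor
  · obtain ⟨hxA, hAx⟩ := Submodule.smul_mem (eigenspace A (-ρ)) ‖x‖⁻¹ hx
    refine ⟨⟨_, hxA⟩, hunit, ?_, ?_⟩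
    · rw [Submodule.mem_orthogonal_singleton_iff_inner_right, real_inner_smul_right, horth,
        mul_zero]
    · rw [hAx, real_inner_smul_right, real_inner_self_eq_norm_sq, hunit, one_pow, mul_one]
  · rintro _ ⟨h, hone, ho, rfl⟩
    have hgap := hA.mul_norm_sq_sub_inner_sq_le hρ hlam he hnorm h
    rw [(Submodule.mem_orthogonal_singleton_iff_inner_left).1 ho, hone] at hgap
    linarith

end Gap

section Eigenspace

lemma dissipation_eq_of_mem_eigenspace (hA : Λ.IsMaximal ρ lam A) (hρ : 0 ≤ ρ) (hlam : 0 ≤ lam)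
    {g : lp E 2} (hg : g ∈ eigenspace A (-ρ)) (hmean : ∀ n, inner ℝ (g n) (Λ.one n) = 0) (n : ℕ) :
    Λ.dissipation ρ lam g n = ρ * ‖g (n + 1)‖ ^ 2 := by
  have hg0 : g 0 = 0 := Λ.eq_zero_of_inner_one_eq_zero _ (hmean 0)
  obtain ⟨hgA, hAg⟩ := hg
  have hdiss := hA.hasSum_dissipation hρ hlam ⟨g, hgA⟩
  rw [hAg, real_inner_smul_right, real_inner_self_eq_norm_sq, neg_mul, neg_neg] at hdiss
  have hnorm : HasSum (fun n => ρ * ‖g (n + 1)‖ ^ 2) (ρ * ‖g‖ ^ 2) := by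
    simpa [hg0] using ((hasSum_nat_add_iff' 1).2 (hasSum_norm_sq g)).mul_left ρ
  have hzero := (hasSum_zero_iff_of_nonneg fun n => sub_nonneg.2
    (Λ.mul_norm_sq_le_dissipation hρ hlam (hmean (n + 1)))).1 (sub_self (ρ * ‖g‖ ^ 2) ▸
      hdiss.sub hnorm)
  exact sub_eq_zero.1 (congrFun hzero n)

lemma isCoherent_of_mem_eigenspace (hA : Λ.IsMaximal ρ lam A) (hρ : 0 < ρ) (hlam : 0 < lam)
    {g : lp E 2} (hg : g ∈ eigenspace A (-ρ)) (h0 : inner ℝ (g 0) (Λ.one 0) = 0) :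
    Λ.IsCoherent g := by
  have hgen := hA.mem_eigenspace_iff.1 hg
  have hmean := Λ.inner_one_eq_zero_of_gen_eq_neg_smul hρ.ne' hgen h0
  have hdiss := hA.dissipation_eq_of_mem_eigenspace hρ.le hlam.le hg hmean
  have hlower (n : ℕ) := Λ.lower_eq_of_dissipation_eq hρ hlam.le (hmean (n + 1)) (hdiss n)
  have hcoll (n : ℕ) := Λ.coll_eq_zero_of_dissipation_eq hρ.le hlam (hmean (n + 1)) (hdiss n)
  refine ⟨Λ.eq_zero_of_inner_one_eq_zero _ h0, fun n => ?_, hlower, fun n => ?_⟩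
  · have hn := hgen (n + 1)
    rw [gen, hlower, hcoll, sub_self, smul_zero, smul_zero, add_zero, add_zero, neg_smul,
      ← smul_neg] at hn
    rw [sub_eq_iff_eq_add.1 (smul_right_injective _ hρ.ne' hn)]
    module
  · cases n with
    | zero => exact Λ.coll_zero _
    | succ n => exact hcoll n

lemma eigenspace_eq_span (hA : Λ.IsMaximal ρ lam A) (hρ : 0 < ρ) (hlam : 0 < lam)
    {e₁ x : lp E 2} (he₁ : e₁ ∈ eigenspace A (-ρ)) (he₁0 : inner ℝ (e₁ 0) (Λ.one 0) ≠ 0)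
    (hx : Λ.IsCoherent x)
    (hspan : ∀ f : E 1, inner ℝ f (Λ.one 1) = 0 → Λ.coll 2 (Λ.raise 1 f) = 0 →
      ∃ t : ℝ, f = t • x 1) :
    eigenspace A (-ρ) = Submodule.span ℝ {e₁, x} := by
  refine le_antisymm (fun h hh => ?_) ?_
  · set t := inner ℝ (h 0) (Λ.one 0) / inner ℝ (e₁ 0) (Λ.one 0) with ht
    have hg : h - t • e₁ ∈ eigenspace A (-ρ) :=
      Submodule.sub_mem _ hh (Submodule.smul_mem _ t he₁)
    have hcoh : Λ.IsCoherent (h - t • e₁ : lp E 2) := by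
      refine hA.isCoherent_of_mem_eigenspace hρ hlam hg ?_
      rw [lp.coeFn_sub, Pi.sub_apply, lp.coeFn_smul, Pi.smul_apply, inner_sub_left,
        real_inner_smul_left, ht, div_mul_cancel₀ _ he₁0, sub_self]
    have hmean := Λ.inner_one_eq_zero_of_gen_eq_neg_smul hρ.ne' (hA.mem_eigenspace_iff.1 hg)
      (by rw [hcoh.zero, inner_zero_left])
    obtain ⟨s, hs⟩ := hspan _ (hmean 1) (by
      rw [hcoh.raise, (Λ.isLinearMap_coll _).map_smul, hcoh.coll, smul_zero])
    have hgx : h - t • e₁ = s • x := lp.ext (funext (hx.eq_smul hcoh hs))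
    exact Submodule.mem_span_pair.2 ⟨t, s, by rw [← hgx, add_sub_cancel]⟩
  · rw [Submodule.span_le, Set.insert_subset_iff, Set.singleton_subset_iff]
    exact ⟨he₁, hA.mem_eigenspace_iff.2 hx.gen_eq⟩

end Eigenspace

end IsMaximal

end Ladder

section Average

variable {Ω X Y : Type*} [MeasurableSpace Ω] [MeasurableSpace X] [MeasurableSpace Y]

lemma integral_comp_measurePreserving {μX : Measure X} {μY : Measure Y} {T : X → Y}
    (hT : MeasurePreserving T μX μY) {f : Y → ℝ} (hf : AEStronglyMeasurable f μY) :
    ∫ x, f (T x) ∂μX = ∫ y, f y ∂μY := by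
  rw [← hT.map_eq] at hf ⊢
  exact (integral_map hT.measurable.aemeasurable hf).symm

variable {P : Measure Ω} [IsProbabilityMeasure P] {νX : Measure X} [IsFiniteMeasure νX]
  {νY : Measure Y} {f : Y → ℝ}

lemma sq_integral_le_integral_sq {f : Ω → ℝ} (hf : MemLp f 2 P) :
    (∫ ω, f ω ∂P) ^ 2 ≤ ∫ ω, f ω ^ 2 ∂P :=
  sub_nonneg.1 ((ProbabilityTheory.variance_nonneg f P).trans_eq
    (ProbabilityTheory.variance_eq_sub hf))

lemma memLp_average {T : Ω × X → Y} (hT : MeasurePreserving T (P.prod νX) νY) (hf : MemLp f 2 νY) :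
    MemLp (fun x => ∫ ω, f (T (ω, x)) ∂P) 2 νX := by
  have hfT : MemLp (fun z => f (T z)) 2 (P.prod νX) := hf.comp_measurePreserving hT
  have hfT1 : Integrable (fun z => f (T z)) (P.prod νX) := hfT.integrable (by norm_num)
  have hmeas : AEStronglyMeasurable (fun x => ∫ ω, f (T (ω, x)) ∂P) νX :=
    hfT1.integral_prod_right.aestronglyMeasurable
  rw [memLp_two_iff_integrable_sq hmeas]
  refine hfT.integrable_sq.integral_prod_right.mono' (hmeas.pow 2) ?_
  filter_upwards [hfT1.prod_left_ae, hfT.integrable_sq.prod_left_ae] with x hx1 hx2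
  rw [Real.norm_of_nonneg (sq_nonneg _)]
  exact sq_integral_le_integral_sq ((memLp_two_iff_integrable_sq hx1.aestronglyMeasurable).2 hx2)

lemma integral_average_mul {T : Ω × X → Y} (hT : MeasurePreserving T (P.prod νX) νY)
    (hf : MemLp f 2 νY) {g : X → ℝ} (hg : MemLp g 2 νX) :
    ∫ x, (∫ ω, f (T (ω, x)) ∂P) * g x ∂νX = ∫ z, f (T z) * g z.2 ∂(P.prod νX) := by
  have hgsnd : MemLp (fun z : Ω × X => g z.2) 2 (P.prod νX) :=
    hg.comp_measurePreserving measurePreserving_snd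
  rw [integral_prod_symm (fun z => f (T z) * g z.2)
    ((hf.comp_measurePreserving hT).integrable_mul hgsnd)]
  simp only [integral_mul_const]

lemma integral_average_mul_comm {T : Ω × X → X} (hT : MeasurePreserving T (P.prod νX) νX)
    {S : Ω × X → Ω × X} (hS : MeasurePreserving S (P.prod νX) (P.prod νX))
    (hST : ∀ z, (S z).2 = T z) (hTS : ∀ z, T (S z) = z.2) {f g : X → ℝ} (hf : MemLp f 2 νX)
    (hg : MemLp g 2 νX) :
    ∫ x, (∫ ω, f (T (ω, x)) ∂P) * g x ∂νX = ∫ x, f x * ∫ ω, g (T (ω, x)) ∂P ∂νX := by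
  have hmeas : AEStronglyMeasurable (fun z => f (T z) * g z.2) (P.prod νX) :=
    (hf.comp_measurePreserving hT).aestronglyMeasurable.mul
      (hg.comp_measurePreserving measurePreserving_snd).aestronglyMeasurable
  simp only [mul_comm (f _) (∫ _, _ ∂P)]
  rw [integral_average_mul hT hf hg, integral_average_mul hT hg hf,
    ← integral_comp_measurePreserving hS hmeas]
  simp only [hST, hTS, mul_comm]

lemma integral_average_mul_self_le {T : Ω × X → X} (hT : MeasurePreserving T (P.prod νX) νX)
    {f : X → ℝ} (hf : MemLp f 2 νX) :
    ∫ x, (∫ ω, f (T (ω, x)) ∂P) * f x ∂νX ≤ ∫ x, f x * f x ∂νX := by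
  have hfT : MemLp (fun z => f (T z)) 2 (P.prod νX) := hf.comp_measurePreserving hT
  have hfsnd : MemLp (fun z : Ω × X => f z.2) 2 (P.prod νX) :=
    hf.comp_measurePreserving measurePreserving_snd
  have hsq := hf.aestronglyMeasurable.pow 2
  calc ∫ x, (∫ ω, f (T (ω, x)) ∂P) * f x ∂νX
      = ∫ z, f (T z) * f z.2 ∂(P.prod νX) := integral_average_mul hT hf hf
    _ ≤ ∫ z, (f (T z) ^ 2 + f z.2 ^ 2) / 2 ∂(P.prod νX) :=
        integral_mono (hfT.integrable_mul hfsnd)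
          ((hfT.integrable_sq.add hfsnd.integrable_sq).div_const 2) fun z => by
            linarith [sq_nonneg (f (T z) - f z.2)]
    _ = (∫ x, f x ^ 2 ∂νX + ∫ x, f x ^ 2 ∂νX) / 2 := by
        rw [integral_div, integral_add hfT.integrable_sq hfsnd.integrable_sq]
        congr 2
        · exact integral_comp_measurePreserving hT hsq
        · exact integral_comp_measurePreserving measurePreserving_snd hsq
    _ = ∫ x, f x * f x ∂νX := by
        rw [add_self_div_two]
        simp only [sq]

end Average

section Gaussian

lemma measurePreserving_withDensity {X Y : Type*} [MeasurableSpace X] [MeasurableSpace Y]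
    {μX : Measure X} {μY : Measure Y} {T : X → Y} (hT : MeasurePreserving T μX μY)
    {p : X → ENNReal} {q : Y → ENNReal} (hq : Measurable q) (hpq : ∀ x, p x = q (T x)) :
    MeasurePreserving T (μX.withDensity p) (μY.withDensity q) := by
  refine ⟨hT.measurable, ?_⟩
  ext s hs
  rw [Measure.map_apply hT.measurable hs, withDensity_apply _ (hT.measurable hs),
    withDensity_apply _ hs, ← hT.setLIntegral_comp_preimage hs hq]
  simp only [hpq]

/-- The Gaussian measure `e^{-π w²} dw`. -/
noncomputable def gauss : Measure ℝ :=
  volume.withDensity fun w => ENNReal.ofReal (Real.exp (-Real.pi * w ^ 2))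

/-- The Gaussian measure `γ_N(v) dv`. -/
noncomputable def gaussN (N : ℕ) : Measure (Fin N → ℝ) :=
  volume.withDensity fun v => ENNReal.ofReal (maxwell v)

lemma integral_gauss (f : ℝ → ℝ) : ∫ w, f w ∂gauss = ∫ w, Real.exp (-Real.pi * w ^ 2) * f w := by
  rw [gauss, integral_withDensity_eq_integral_toReal_smul (by fun_prop) (by simp)]
  simp only [ENNReal.toReal_ofReal (Real.exp_pos _).le, smul_eq_mul]

lemma integrable_gauss_iff {f : ℝ → ℝ} :
    Integrable f gauss ↔ Integrable fun w => Real.exp (-Real.pi * w ^ 2) * f w := by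
  rw [gauss, integrable_withDensity_iff_integrable_smul' (by fun_prop) (by simp)]
  simp only [ENNReal.toReal_ofReal (Real.exp_pos _).le, smul_eq_mul]

lemma ae_gauss_iff {p : ℝ → Prop} : (∀ᵐ w ∂gauss, p w) ↔ ∀ᵐ w, p w := by
  rw [gauss, ae_withDensity_iff (by fun_prop)]
  simp [Real.exp_pos]

instance : IsProbabilityMeasure gauss := by
  constructor
  rw [gauss, withDensity_apply _ MeasurableSet.univ, Measure.restrict_univ,
    ← ofReal_integral_eq_lintegral_ofReal (integrable_exp_neg_mul_sq Real.pi_pos)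
      (.of_forall fun w => (Real.exp_pos _).le), integral_gaussian]
  simp

variable {N : ℕ}

lemma measurable_maxwell : Measurable fun v : Fin N → ℝ => ENNReal.ofReal (maxwell v) :=
  continuous_maxwell.measurable.ennreal_ofReal

lemma ae_gaussN_iff {p : (Fin N → ℝ) → Prop} : (∀ᵐ v ∂gaussN N, p v) ↔ ∀ᵐ v, p v := by
  rw [gaussN, ae_withDensity_iff measurable_maxwell]
  simp [maxwell_pos]

lemma integrable_gaussN_iff {f : (Fin N → ℝ) → ℝ} :
    Integrable f (gaussN N) ↔ Integrable fun v => maxwell v * f v := by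
  rw [gaussN, integrable_withDensity_iff_integrable_smul' measurable_maxwell (by simp)]
  simp only [ENNReal.toReal_ofReal (maxwell_pos _).le, smul_eq_mul]

instance : IsFiniteMeasure (gaussN N) :=
  isFiniteMeasure_withDensity_ofReal (integrable_maxwell N).2

lemma measurePreserving_insertNth (i : Fin (N + 1)) :
    MeasurePreserving (fun z : ℝ × (Fin N → ℝ) => (i.insertNth z.1 z.2 : Fin (N + 1) → ℝ))
      (gauss.prod (gaussN N)) (gaussN (N + 1)) := by
  rw [gauss, gaussN, prod_withDensity (by fun_prop) measurable_maxwell]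
  refine measurePreserving_withDensity
    (volume_preserving_piFinSuccAbove (fun _ : Fin (N + 1) => ℝ) i).symm measurable_maxwell
    fun z => ?_
  change _ = ENNReal.ofReal (maxwell (i.insertNth z.1 z.2 : Fin (N + 1) → ℝ))
  rw [maxwell_insertNth, ENNReal.ofReal_mul (Real.exp_pos _).le]

lemma measurePreserving_cons :
    MeasurePreserving (fun z : ℝ × (Fin N → ℝ) => (Fin.cons z.1 z.2 : Fin (N + 1) → ℝ))
      (gauss.prod (gaussN N)) (gaussN (N + 1)) := by
  simpa only [Fin.insertNth_zero'] using measurePreserving_insertNth (0 : Fin (N + 1))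

lemma gaussN_univ (N : ℕ) : gaussN N Set.univ = 1 := by
  induction N with
  | zero =>
    rw [gaussN, withDensity_apply _ MeasurableSet.univ, Measure.restrict_univ]
    simp [maxwell, volume_pi]
  | succ N ih =>
    rw [← measurePreserving_cons.measure_preimage MeasurableSet.univ.nullMeasurableSet,
      Set.preimage_univ, ← Set.univ_prod_univ, Measure.prod_prod, ih, measure_univ, one_mul]

instance : IsProbabilityMeasure (gaussN N) := ⟨gaussN_univ N⟩

lemma measurePreserving_removeNth (i : Fin (N + 1)) :
    MeasurePreserving (fun v : Fin (N + 1) → ℝ => i.removeNth v) (gaussN (N + 1)) (gaussN N) := by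
  have hinsert := measurePreserving_insertNth (N := N) i
  rw [← hinsert.map_eq]
  refine .map_of_comp ?_ (measurable_pi_lambda _ fun k => measurable_pi_apply _) hinsert.measurable
  simpa only [Function.comp_def, Fin.removeNth_insertNth] using measurePreserving_snd

lemma measurePreserving_eval_gaussN (i : Fin N) :
    MeasurePreserving (fun v : Fin N → ℝ => v i) (gaussN N) gauss := by
  cases N with
  | zero => exact i.elim0
  | succ N =>
    have hinsert := measurePreserving_insertNth (N := N) i
    rw [← hinsert.map_eq]
    refine .map_of_comp ?_ (measurable_pi_apply _) hinsert.measurable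
    simpa only [Function.comp_def, Fin.insertNth_apply_same] using measurePreserving_fst

lemma measurePreserving_rot_gaussN {i j : Fin N} (hij : i ≠ j) (θ : ℝ) :
    MeasurePreserving (rot i j θ) (gaussN N) (gaussN N) :=
  measurePreserving_withDensity (measurePreserving_rot hij θ) measurable_maxwell fun v => by
    simp only [maxwell, rot_sum_sq hij]

lemma levelMeasure_eq {ρ μ : ℝ} (hρ : 0 < ρ) (hμ : 0 < μ) (N : ℕ) :
    levelMeasure ρ μ N = ENNReal.ofReal (weight ρ μ N) • gaussN N := by
  rw [levelMeasure, gaussN, ← withDensity_smul _ measurable_maxwell]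
  simp only [ENNReal.ofReal_mul (weight_pos hρ hμ N).le, Pi.smul_def, smul_eq_mul]

end Gaussian

section UniformAngle

/-- The uniform probability measure on the angles `(0, 2π]`. -/
noncomputable def unif : Measure ℝ :=
  ENNReal.ofReal (1 / (2 * Real.pi)) • volume.restrict (Set.Ioc 0 (2 * Real.pi))

instance : IsProbabilityMeasure unif := by
  constructor
  rw [unif, Measure.smul_apply, Measure.restrict_apply_univ, Real.volume_Ioc, smul_eq_mul,
    ← ENNReal.ofReal_mul (by positivity), sub_zero, one_div_mul_cancel Real.two_pi_pos.ne',
    ENNReal.ofReal_one]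

lemma Rcol_eq_integral_unif {N : ℕ} (i j : Fin N) (f : (Fin N → ℝ) → ℝ) :
    Rcol i j f = fun v => ∫ θ, f (rot i j θ v) ∂unif := by
  funext v
  rw [Rcol, unif, integral_smul_measure, intervalIntegral.integral_of_le (by positivity),
    ENNReal.toReal_ofReal (by positivity), smul_eq_mul]

lemma measurePreserving_sub_left_unif :
    MeasurePreserving (fun θ : ℝ => 2 * Real.pi - θ) unif unif := by
  have h := (Measure.measurePreserving_sub_left (volume : Measure ℝ)
    (2 * Real.pi)).restrict_preimage (measurableSet_Ioc (a := (0 : ℝ)) (b := 2 * Real.pi))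
  rw [Set.preimage_const_sub_Ioc, sub_self, sub_zero,
    Measure.restrict_congr_set Ico_ae_eq_Ioc] at h
  exact h.smul_measure _

lemma measurePreserving_rot_unif {N : ℕ} {i j : Fin N} (hij : i ≠ j) :
    MeasurePreserving (fun z : ℝ × (Fin N → ℝ) => rot i j z.1 z.2)
      (unif.prod (gaussN N)) (gaussN N) :=
  measurePreserving_snd.comp ((MeasurePreserving.id unif).skew_product
    (g := fun θ v => rot i j θ v) (continuous_rot i j).measurable
    (.of_forall fun θ => (measurePreserving_rot_gaussN hij θ).map_eq))

end UniformAngle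

/-- Square integrable functions on `ℝ^N`, almost everywhere invariant under permutations. -/
structure SymMemLp {N : ℕ} (f : (Fin N → ℝ) → ℝ) : Prop where
  memLp : MemLp f 2 (gaussN N)
  symm : ∀ σ : Equiv.Perm (Fin N), ∀ᵐ v, f (v ∘ σ) = f v

section Levels

variable {ρ μ : ℝ} {N : ℕ}

lemma memLp_level_iff (hρ : 0 < ρ) (hμ : 0 < μ) {f : (Fin N → ℝ) → ℝ} :
    MemLp f 2 (levelMeasure ρ μ N) ↔ MemLp f 2 (gaussN N) := by
  have hw : ENNReal.ofReal (weight ρ μ N) ≠ 0 := by simpa using weight_pos hρ hμ N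
  rw [levelMeasure_eq hρ hμ]
  refine ⟨fun h => ?_, fun h => h.smul_measure ENNReal.ofReal_ne_top⟩
  have h' := h.smul_measure (ENNReal.inv_ne_top.2 hw)
  rwa [smul_smul, ENNReal.inv_mul_cancel hw ENNReal.ofReal_ne_top, one_smul] at h'

lemma symMemLp_coe (hρ : 0 < ρ) (hμ : 0 < μ) (x : symL2 ρ μ N) : SymMemLp x.1 where
  memLp := (memLp_level_iff hρ hμ).1 (Lp.memLp _)
  symm σ := (ae_level_iff hρ hμ).1 (x.2 σ)

lemma symL2_ext (hρ : 0 < ρ) (hμ : 0 < μ) {x y : symL2 ρ μ N} (h : ∀ᵐ v, x.1 v = y.1 v) : x = y :=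
  Subtype.ext (Lp.ext ((ae_level_iff hρ hμ).2 h))

lemma integral_levelMeasure (hρ : 0 < ρ) (hμ : 0 < μ) (F : (Fin N → ℝ) → ℝ) :
    ∫ v, F v ∂levelMeasure ρ μ N = weight ρ μ N * ∫ v, F v ∂gaussN N := by
  rw [levelMeasure_eq hρ hμ, integral_smul_measure,
    ENNReal.toReal_ofReal (weight_pos hρ hμ N).le, smul_eq_mul]

lemma inner_symL2 (hρ : 0 < ρ) (hμ : 0 < μ) (x y : symL2 ρ μ N) :
    inner ℝ x y = weight ρ μ N * ∫ v, x.1 v * y.1 v ∂gaussN N := by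
  rw [Submodule.coe_inner, L2.inner_def, integral_levelMeasure hρ hμ]
  simp only [RCLike.inner_apply, conj_trivial, mul_comm]

/-- The class of a symmetric square integrable function. -/
noncomputable def toSym (hρ : 0 < ρ) (hμ : 0 < μ) (f : (Fin N → ℝ) → ℝ) (hf : SymMemLp f) :
    symL2 ρ μ N :=
  ⟨((memLp_level_iff hρ hμ).2 hf.memLp).toLp f, fun σ => by
    have hcoe := ((memLp_level_iff hρ hμ).2 hf.memLp).coeFn_toLp
    have hcoeσ := (measurePreserving_perm_level ρ μ σ).quasiMeasurePreserving.ae_eq_comp hcoe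
    filter_upwards [hcoe, hcoeσ, (ae_level_iff hρ hμ).2 (hf.symm σ)] with v hv hvσ hsymm
    exact (hvσ.trans hsymm).trans hv.symm⟩

variable (hρ : 0 < ρ) (hμ : 0 < μ)

lemma coe_toSym {f : (Fin N → ℝ) → ℝ} (hf : SymMemLp f) :
    ∀ᵐ v, (toSym hρ hμ f hf).1 v = f v :=
  (ae_level_iff hρ hμ).1 ((memLp_level_iff hρ hμ).2 hf.memLp).coeFn_toLp

lemma eq_toSym {x : symL2 ρ μ N} {f : (Fin N → ℝ) → ℝ} (hf : SymMemLp f)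
    (h : ∀ᵐ v, x.1 v = f v) : x = toSym hρ hμ f hf :=
  symL2_ext hρ hμ (by
    filter_upwards [h, coe_toSym hρ hμ hf] with v hv hv'
    exact hv.trans hv'.symm)

lemma toSym_congr {f g : (Fin N → ℝ) → ℝ} (hf : SymMemLp f) (hg : SymMemLp g)
    (h : ∀ᵐ v, f v = g v) : toSym hρ hμ f hf = toSym hρ hμ g hg :=
  eq_toSym hρ hμ hg (by
    filter_upwards [h, coe_toSym hρ hμ hf] with v hv hv'
    exact hv'.trans hv)

lemma toSym_coe (x : symL2 ρ μ N) : toSym hρ hμ x.1 (symMemLp_coe hρ hμ x) = x :=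
  (eq_toSym hρ hμ _ (.of_forall fun _ => rfl)).symm

lemma inner_toSym_right {f : (Fin N → ℝ) → ℝ} (hf : SymMemLp f) (x : symL2 ρ μ N) :
    inner ℝ x (toSym hρ hμ f hf) = weight ρ μ N * ∫ v, x.1 v * f v ∂gaussN N := by
  rw [inner_symL2 hρ hμ]
  congr 1
  refine integral_congr_ae ?_
  filter_upwards [ae_gaussN_iff.2 (coe_toSym hρ hμ hf)] with v hv
  rw [hv]

lemma inner_toSym_left {f : (Fin N → ℝ) → ℝ} (hf : SymMemLp f) (x : symL2 ρ μ N) :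
    inner ℝ (toSym hρ hμ f hf) x = weight ρ μ N * ∫ v, f v * x.1 v ∂gaussN N := by
  rw [real_inner_comm, inner_toSym_right]
  simp only [mul_comm]

end Levels

section CreationAnnihilation

/-- The creation operator `P⁺` between consecutive levels. -/
def plusF {N : ℕ} (f : (Fin N → ℝ) → ℝ) : (Fin (N + 1) → ℝ) → ℝ := fun v =>
  ∑ i : Fin (N + 1), f (i.removeNth v)

/-- The annihilation operator `P⁻` between consecutive levels. -/
noncomputable def minusF {N : ℕ} (f : (Fin (N + 1) → ℝ) → ℝ) : (Fin N → ℝ) → ℝ := fun v =>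
  1 / ((N : ℝ) + 1) *
    ∑ i : Fin (N + 1), ∫ w : ℝ, Real.exp (-Real.pi * w ^ 2) * f (i.insertNth w v)

variable {N : ℕ}

lemma plusF_congr {f g : (Fin N → ℝ) → ℝ} (h : ∀ᵐ v, f v = g v) :
    ∀ᵐ v, plusF f v = plusF g v := by
  filter_upwards [ae_all_iff.2 fun i : Fin (N + 1) => ae_removeNth i h] with v hv
  simp only [plusF, hv]

lemma minusF_congr {f g : (Fin (N + 1) → ℝ) → ℝ} (h : ∀ᵐ v, f v = g v) :
    ∀ᵐ v, minusF f v = minusF g v := by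
  filter_upwards [ae_all_iff.2 fun i : Fin (N + 1) => ae_insertNth i h] with v hv
  rw [minusF, minusF]
  congr 1
  refine Finset.sum_congr rfl fun i _ => integral_congr_ae ?_
  filter_upwards [hv i] with w hw
  rw [hw]

lemma ae_perm {p : (Fin N → ℝ) → Prop} (σ : Equiv.Perm (Fin N)) (h : ∀ᵐ v, p v) :
    ∀ᵐ v : Fin N → ℝ, p (v ∘ σ) :=
  (measurePreserving_perm σ).quasiMeasurePreserving.ae h

lemma ae_cons {p : (Fin (N + 1) → ℝ) → Prop} (hp : ∀ᵐ v, p v) :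
    ∀ᵐ v : Fin N → ℝ, ∀ᵐ w : ℝ, p (Fin.cons w v) := by
  simpa only [Fin.insertNth_zero'] using ae_insertNth (0 : Fin (N + 1)) hp

lemma exists_removeNth_comp (σ : Equiv.Perm (Fin (N + 1))) (i : Fin (N + 1)) :
    ∃ τ : Equiv.Perm (Fin N), ∀ v : Fin (N + 1) → ℝ,
      (i.removeNth (v ∘ σ) : Fin N → ℝ) = (σ i).removeNth v ∘ τ := by
  let e : {x // x ≠ i} ≃ {x // x ≠ σ i} := σ.subtypeEquiv fun x => by simp
  refine ⟨(finSuccAboveEquiv i).trans (e.trans (finSuccAboveEquiv (σ i)).symm),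
    fun v => funext fun k => congrArg v ?_⟩
  exact (congrArg Subtype.val ((finSuccAboveEquiv (σ i)).apply_symm_apply
    (e (finSuccAboveEquiv i k)))).symm

lemma cons_comp (σ : Equiv.Perm (Fin N)) (w : ℝ) (v : Fin N → ℝ) :
    (Fin.cons w (v ∘ σ) : Fin (N + 1) → ℝ) =
      (Fin.cons w v : Fin (N + 1) → ℝ) ∘ Equiv.Perm.decomposeFin.symm (0, σ) := by
  funext k
  refine Fin.cases ?_ (fun k => ?_) k <;> simp

lemma removeNth_succ_cons (j : Fin (N + 1)) (w : ℝ) (v : Fin (N + 1) → ℝ) :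
    (j.succ.removeNth (Fin.cons w v : Fin (N + 2) → ℝ) : Fin (N + 1) → ℝ) =
      Fin.cons w (j.removeNth v) := by
  funext k
  refine Fin.cases ?_ (fun k => ?_) k <;> simp [Fin.removeNth_apply]

namespace SymMemLp

lemma integrable {f : (Fin N → ℝ) → ℝ} (hf : SymMemLp f) : Integrable fun v => maxwell v * f v :=
  integrable_gaussN_iff.1 (hf.memLp.integrable (by norm_num))

protected lemma plusF {f : (Fin N → ℝ) → ℝ} (hf : SymMemLp f) : SymMemLp (plusF f) where
  memLp := memLp_finsetSum _ fun i _ =>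
    hf.memLp.comp_measurePreserving (measurePreserving_removeNth i)
  symm σ := by
    choose τ hτ using exists_removeNth_comp σ
    filter_upwards [ae_all_iff.2 fun i => ae_removeNth (σ i) (hf.symm (τ i))] with v hv
    simp only [KacReservoir.plusF, hτ, hv]
    exact Equiv.sum_comp σ fun i => f (i.removeNth v)

-- By symmetry all `N + 1` summands of `minusF` agree.
lemma minusF_ae_eq {f : (Fin (N + 1) → ℝ) → ℝ} (hf : SymMemLp f) :
    ∀ᵐ v, minusF f v = ∫ w, f (Fin.cons w v) ∂gauss := by
  have hsymm := ae_all_iff.2 fun i : Fin (N + 1) => ae_cons (hf.symm i.cycleRange)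
  filter_upwards [hsymm] with v hv
  have hsummand (i : Fin (N + 1)) :
      ∫ w : ℝ, Real.exp (-Real.pi * w ^ 2) * f (i.insertNth w v) =
        ∫ w, f (Fin.cons w v) ∂gauss := by
    rw [integral_gauss]
    refine integral_congr_ae ?_
    filter_upwards [hv i] with w hw
    rw [← hw, Fin.cons_comp_cycleRange]
  simp only [minusF, hsummand, Finset.sum_const, Finset.card_univ, Fintype.card_fin, nsmul_eq_mul]
  push_cast
  rw [← mul_assoc, one_div_mul_cancel N.cast_add_one_ne_zero, one_mul]

protected lemma minusF {f : (Fin (N + 1) → ℝ) → ℝ} (hf : SymMemLp f) : SymMemLp (minusF f) where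
  memLp := (memLp_average measurePreserving_cons hf.memLp).ae_eq
    (ae_gaussN_iff.2 (hf.minusF_ae_eq.mono fun _ => Eq.symm))
  symm σ := by
    filter_upwards [hf.minusF_ae_eq, ae_perm σ hf.minusF_ae_eq,
      ae_cons (hf.symm (Equiv.Perm.decomposeFin.symm (0, σ)))] with v hv hvσ hsymm
    rw [hv, hvσ]
    refine integral_congr_ae (ae_gauss_iff.2 ?_)
    filter_upwards [hsymm] with w hw
    rw [cons_comp, hw]

lemma minusF_plusF_zero {f : (Fin 0 → ℝ) → ℝ} (hf : SymMemLp f) :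
    ∀ᵐ v, KacReservoir.minusF (KacReservoir.plusF f) v = f v := by
  filter_upwards [hf.plusF.minusF_ae_eq] with v hv
  have hplus (w : ℝ) : KacReservoir.plusF f (Fin.cons w v) = f v := by
    rw [KacReservoir.plusF, Fin.sum_univ_one]
    exact congrArg f (Subsingleton.elim _ _)
  simp only [hv, hplus, integral_const, probReal_univ, one_smul]

lemma minusF_plusF {f : (Fin (N + 1) → ℝ) → ℝ} (hf : SymMemLp f) :
    ∀ᵐ v, KacReservoir.minusF (KacReservoir.plusF f) v =
      KacReservoir.plusF (KacReservoir.minusF f) v + f v := by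
  have hint := ae_all_iff.2 fun j : Fin (N + 1) => ae_removeNth j
    (integrable_insertNth 0 hf.integrable)
  filter_upwards [hf.plusF.minusF_ae_eq, plusF_congr hf.minusF_ae_eq, hint] with v hv hv' hvint
  have hsum (w : ℝ) : KacReservoir.plusF f (Fin.cons w v) =
      f v + ∑ j : Fin (N + 1), f (Fin.cons w (j.removeNth v)) := by
    rw [KacReservoir.plusF, Fin.sum_univ_succ]
    simp only [removeNth_succ_cons]
    simp
  have hintj (j : Fin (N + 1)) :
      Integrable (fun w => f (Fin.cons w (j.removeNth v))) gauss := by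
    simpa only [integrable_gauss_iff, Fin.insertNth_zero'] using hvint j
  rw [hv, hv']
  simp only [hsum]
  rw [integral_add (integrable_const _) (integrable_finsetSum _ fun j _ => hintj j),
    integral_finsetSum _ fun j _ => hintj j, integral_const, probReal_univ, one_smul, add_comm]
  rfl

end SymMemLp

lemma integral_removeNth_mul (i : Fin (N + 1)) {f : (Fin N → ℝ) → ℝ}
    {g : (Fin (N + 1) → ℝ) → ℝ} (hf : MemLp f 2 (gaussN N)) (hg : MemLp g 2 (gaussN (N + 1))) :
    ∫ v, f (i.removeNth v) * g v ∂gaussN (N + 1) =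
      ∫ v, f v * ∫ w, g (i.insertNth w v) ∂gauss ∂gaussN N := by
  have hmeas : AEStronglyMeasurable (fun v => f (i.removeNth v) * g v) (gaussN (N + 1)) :=
    (hf.comp_measurePreserving (measurePreserving_removeNth i)).aestronglyMeasurable.mul
      hg.aestronglyMeasurable
  simp only [mul_comm (f _) (∫ _, _ ∂gauss)]
  rw [integral_average_mul (measurePreserving_insertNth i) hg hf,
    ← integral_comp_measurePreserving (measurePreserving_insertNth i) hmeas]
  simp only [Fin.removeNth_insertNth, mul_comm]

lemma integral_plusF_mul {f : (Fin N → ℝ) → ℝ} {g : (Fin (N + 1) → ℝ) → ℝ}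
    (hf : MemLp f 2 (gaussN N)) (hg : MemLp g 2 (gaussN (N + 1))) :
    ∫ v, plusF f v * g v ∂gaussN (N + 1) = ((N : ℝ) + 1) * ∫ v, f v * minusF g v ∂gaussN N := by
  have hremove (i : Fin (N + 1)) :
      Integrable (fun v => f (i.removeNth v) * g v) (gaussN (N + 1)) :=
    (hf.comp_measurePreserving (measurePreserving_removeNth i)).integrable_mul hg
  have hinsert (i : Fin (N + 1)) :
      Integrable (fun v => f v * ∫ w, g (i.insertNth w v) ∂gauss) (gaussN N) :=
    hf.integrable_mul (memLp_average (measurePreserving_insertNth i) hg)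
  calc ∫ v, plusF f v * g v ∂gaussN (N + 1)
      = ∑ i : Fin (N + 1), ∫ v, f (i.removeNth v) * g v ∂gaussN (N + 1) := by
        simp only [plusF, Finset.sum_mul]
        exact integral_finsetSum _ fun i _ => hremove i
    _ = ∫ v, f v * ∑ i : Fin (N + 1), ∫ w, g (i.insertNth w v) ∂gauss ∂gaussN N := by
        simp only [integral_removeNth_mul _ hf hg, Finset.mul_sum]
        exact (integral_finsetSum _ fun i _ => hinsert i).symm
    _ = ((N : ℝ) + 1) * ∫ v, f v * minusF g v ∂gaussN N := by
        simp only [minusF, ← integral_gauss]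
        rw [← integral_const_mul]
        congr 1 with v
        field_simp

end CreationAnnihilation

section Pairs

variable {ι : Type*} [Fintype ι] [LinearOrder ι] {M : Type*} [AddCommMonoid M]

lemma sum_lt_eq_sum_sym2 (p : Sym2 ι → M) :
    ∑ q : ι × ι with q.1 < q.2, p s(q.1, q.2) = ∑ z : Sym2 ι with ¬ z.IsDiag, p z := by
  rw [← Finset.sym2_univ, Finset.sum_sym2_filter_not_isDiag]
  refine Finset.sum_congr ?_ fun _ _ => rfl
  ext q
  simpa using ne_of_lt

lemma sum_lt_comp_perm {g : ι → ι → M} (hg : ∀ i j, g i j = g j i) (σ : Equiv.Perm ι) :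
    ∑ q : ι × ι with q.1 < q.2, g (σ q.1) (σ q.2) = ∑ q : ι × ι with q.1 < q.2, g q.1 q.2 := by
  have hlift := sum_lt_eq_sum_sym2 (Sym2.lift ⟨g, hg⟩)
  have hliftσ := sum_lt_eq_sum_sym2 fun z => Sym2.lift ⟨g, hg⟩ (z.map σ)
  simp only [Sym2.map_mk, Sym2.lift_mk] at hlift hliftσ
  rw [hlift, hliftσ]
  exact Finset.sum_bijective (Sym2.map σ)
    (Finite.injective_iff_bijective.1 (Sym2.map.injective σ.injective))
    (fun z => by simp [Sym2.isDiag_map σ.injective]) fun _ _ => rfl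

end Pairs

section Collisions

/-- The collision operator on one level. -/
noncomputable def kacF {N : ℕ} (f : (Fin N → ℝ) → ℝ) : (Fin N → ℝ) → ℝ := fun v =>
  ∑ p : Fin N × Fin N with p.1 < p.2, (Rcol p.1 p.2 f v - f v)

variable {N : ℕ} {i j : Fin N}

lemma rot_swap (hij : i ≠ j) (θ : ℝ) (v : Fin N → ℝ) :
    rot j i θ v = rot i j (2 * Real.pi - θ) v := by
  funext k
  simp only [rot, Real.cos_two_pi_sub, Real.sin_two_pi_sub]
  split_ifs with hj hi
  · exact absurd (hi.symm.trans hj) hij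
  all_goals ring

lemma rot_two_pi_sub_rot (hij : i ≠ j) (θ : ℝ) (v : Fin N → ℝ) :
    rot i j (2 * Real.pi - θ) (rot i j θ v) = v := by
  funext k
  simp only [rot, Real.cos_two_pi_sub, Real.sin_two_pi_sub, if_true, hij.symm, if_false]
  split_ifs with hi hj
  · subst hi; linear_combination v k * Real.cos_sq_add_sin_sq θ
  · subst hj; linear_combination v k * Real.cos_sq_add_sin_sq θ
  · rfl

lemma rot_comp_perm (σ : Equiv.Perm (Fin N)) (i j : Fin N) (θ : ℝ) (v : Fin N → ℝ) :
    rot i j θ (v ∘ σ) = rot (σ i) (σ j) θ v ∘ σ := by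
  funext k
  simp [rot]

lemma ae_rot_unif (hij : i ≠ j) {p : (Fin N → ℝ) → Prop} (hp : ∀ᵐ v, p v) :
    ∀ᵐ v : Fin N → ℝ, ∀ᵐ θ ∂unif, p (rot i j θ v) :=
  (ae_rot hij hp).mono fun _ hv => Measure.ae_smul_measure hv _

lemma Rcol_swap (i j : Fin N) (f : (Fin N → ℝ) → ℝ) (v : Fin N → ℝ) :
    Rcol i j f v = Rcol j i f v := by
  rcases eq_or_ne i j with rfl | hij
  · rfl
  simp only [Rcol_eq_integral_unif, rot_swap hij]
  exact (measurePreserving_sub_left_unif.integral_comp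
    (Homeomorph.subLeft (2 * Real.pi)).measurableEmbedding fun θ => f (rot i j θ v)).symm

lemma Rcol_congr (hij : i ≠ j) {f g : (Fin N → ℝ) → ℝ} (h : ∀ᵐ v, f v = g v) :
    ∀ᵐ v, Rcol i j f v = Rcol i j g v := by
  filter_upwards [ae_rot_unif hij h] with v hv
  simp only [Rcol_eq_integral_unif]
  exact integral_congr_ae hv

lemma Rcol_comp_perm (σ : Equiv.Perm (Fin N)) (i j : Fin N) (f : (Fin N → ℝ) → ℝ)
    (v : Fin N → ℝ) : Rcol i j f (v ∘ σ) = Rcol (σ i) (σ j) (fun u => f (u ∘ σ)) v := by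
  simp only [Rcol, rot_comp_perm]

lemma ae_forall_lt {p : Fin N → Fin N → (Fin N → ℝ) → Prop}
    (h : ∀ i j, i ≠ j → ∀ᵐ v, p i j v) : ∀ᵐ v, ∀ i j, i < j → p i j v := by
  simp only [ae_all_iff]
  exact fun i j hij => h i j hij.ne

lemma kacF_congr {f g : (Fin N → ℝ) → ℝ} (h : ∀ᵐ v, f v = g v) :
    ∀ᵐ v, kacF f v = kacF g v := by
  filter_upwards [h, ae_forall_lt fun i j hij => Rcol_congr hij h] with v hv hRcol
  exact Finset.sum_congr rfl fun q hq => by rw [hv, hRcol _ _ (Finset.mem_filter.1 hq).2]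

lemma memLp_Rcol (hij : i ≠ j) {f : (Fin N → ℝ) → ℝ} (hf : MemLp f 2 (gaussN N)) :
    MemLp (Rcol i j f) 2 (gaussN N) := by
  rw [Rcol_eq_integral_unif]
  exact memLp_average (measurePreserving_rot_unif hij) hf

lemma integral_Rcol_mul_comm (hij : i ≠ j) {f g : (Fin N → ℝ) → ℝ}
    (hf : MemLp f 2 (gaussN N)) (hg : MemLp g 2 (gaussN N)) :
    ∫ v, Rcol i j f v * g v ∂gaussN N = ∫ v, f v * Rcol i j g v ∂gaussN N := by
  have hreverse : MeasurePreserving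
      (fun z : ℝ × (Fin N → ℝ) => (2 * Real.pi - z.1, rot i j z.1 z.2))
      (unif.prod (gaussN N)) (unif.prod (gaussN N)) :=
    measurePreserving_sub_left_unif.skew_product (g := fun θ v => rot i j θ v)
      (continuous_rot i j).measurable
      (.of_forall fun θ => (measurePreserving_rot_gaussN hij θ).map_eq)
  simp only [Rcol_eq_integral_unif]
  exact integral_average_mul_comm (measurePreserving_rot_unif hij) hreverse (fun _ => rfl)
    (fun z => rot_two_pi_sub_rot hij z.1 z.2) hf hg

lemma integral_mul_Rcol_self_le (hij : i ≠ j) {f : (Fin N → ℝ) → ℝ} (hf : MemLp f 2 (gaussN N)) :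
    ∫ v, f v * Rcol i j f v ∂gaussN N ≤ ∫ v, f v * f v ∂gaussN N := by
  rw [← integral_Rcol_mul_comm hij hf hf, Rcol_eq_integral_unif]
  exact integral_average_mul_self_le (measurePreserving_rot_unif hij) hf

protected lemma SymMemLp.kacF {f : (Fin N → ℝ) → ℝ} (hf : SymMemLp f) : SymMemLp (kacF f) where
  memLp := memLp_finsetSum _ fun _ hq =>
    (memLp_Rcol (Finset.mem_filter.1 hq).2.ne hf.memLp).sub hf.memLp
  symm σ := by
    have hRcol := ae_forall_lt fun i j hij => Rcol_congr (σ.injective.ne hij) (hf.symm σ)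
    filter_upwards [hf.symm σ, hRcol] with v hv hRcol
    calc KacReservoir.kacF f (v ∘ σ)
        = ∑ q : Fin N × Fin N with q.1 < q.2, (Rcol (σ q.1) (σ q.2) f v - f v) :=
          Finset.sum_congr rfl fun q hq => by
            rw [Rcol_comp_perm, hRcol _ _ (Finset.mem_filter.1 hq).2, hv]
      _ = KacReservoir.kacF f v :=
          sum_lt_comp_perm (fun i j => congrArg (· - f v) (Rcol_swap i j f v)) σ

lemma integral_mul_kacF {f g : (Fin N → ℝ) → ℝ} (hf : MemLp f 2 (gaussN N))
    (hg : MemLp g 2 (gaussN N)) :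
    ∫ v, f v * kacF g v ∂gaussN N = ∑ q : Fin N × Fin N with q.1 < q.2,
      (∫ v, f v * Rcol q.1 q.2 g v ∂gaussN N - ∫ v, f v * g v ∂gaussN N) := by
  have hfg : Integrable (fun v => f v * g v) (gaussN N) := hf.integrable_mul hg
  have hfR (q : Fin N × Fin N) (hq : q ∈ Finset.univ.filter fun q : Fin N × Fin N => q.1 < q.2) :
      Integrable (fun v => f v * Rcol q.1 q.2 g v) (gaussN N) :=
    hf.integrable_mul (memLp_Rcol (Finset.mem_filter.1 hq).2.ne hg)
  simp only [kacF, Finset.mul_sum, mul_sub]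
  refine (integral_finsetSum _ fun q hq => (hfR q hq).sub hfg).trans ?_
  exact Finset.sum_congr rfl fun q hq => integral_sub (hfR q hq) hfg

lemma integral_kacF_mul {f g : (Fin N → ℝ) → ℝ} (hf : MemLp f 2 (gaussN N))
    (hg : MemLp g 2 (gaussN N)) :
    ∫ v, kacF f v * g v ∂gaussN N = ∫ v, f v * kacF g v ∂gaussN N := by
  simp only [mul_comm _ (g _)]
  rw [integral_mul_kacF hg hf, integral_mul_kacF hf hg]
  refine Finset.sum_congr rfl fun q hq => ?_
  simp only [mul_comm (g _)]
  rw [integral_Rcol_mul_comm (Finset.mem_filter.1 hq).2.ne hf hg]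

lemma integral_mul_kacF_self_nonpos {f : (Fin N → ℝ) → ℝ} (hf : MemLp f 2 (gaussN N)) :
    ∫ v, f v * kacF f v ∂gaussN N ≤ 0 := by
  rw [integral_mul_kacF hf hf]
  exact Finset.sum_nonpos fun q hq => sub_nonpos.2
    (integral_mul_Rcol_self_le (Finset.mem_filter.1 hq).2.ne hf)

lemma kacF_eq_zero_of_rot_invariant {f : (Fin N → ℝ) → ℝ}
    (hf : ∀ i j : Fin N, i ≠ j → ∀ θ v, f (rot i j θ v) = f v) (v : Fin N → ℝ) :
    kacF f v = 0 :=
  Finset.sum_eq_zero fun q hq => by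
    simp [Rcol_eq_integral_unif, hf _ _ (Finset.mem_filter.1 hq).2.ne]

end Collisions

section Weights

lemma succ_mul_weight_succ (ρ μ : ℝ) (n : ℕ) :
    ((n : ℝ) + 1) * weight ρ μ (n + 1) = μ / ρ * weight ρ μ n := by
  simp only [weight, Nat.factorial_succ, pow_succ]
  push_cast
  field_simp

lemma hasSum_weight (ρ μ : ℝ) : HasSum (weight ρ μ) 1 := by
  have h := (NormedSpace.expSeries_div_hasSum_exp (μ / ρ)).mul_right (Real.exp (-(μ / ρ)))
  rw [← Real.exp_eq_exp_ℝ, ← Real.exp_add, add_neg_cancel, Real.exp_zero] at h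
  refine h.congr_fun fun n => ?_
  rw [weight]
  ring

end Weights

section Ladder

variable {ρ μ : ℝ} {N : ℕ}

lemma symMemLp_const (c : ℝ) : SymMemLp fun _ : Fin N → ℝ => c where
  memLp := memLp_const c
  symm _ := .of_forall fun _ => rfl

lemma SymMemLp.add {f g : (Fin N → ℝ) → ℝ} (hf : SymMemLp f) (hg : SymMemLp g) :
    SymMemLp fun v => f v + g v where
  memLp := hf.memLp.add hg.memLp
  symm σ := by
    filter_upwards [hf.symm σ, hg.symm σ] with v hfv hgv
    rw [hfv, hgv]

lemma SymMemLp.sub {f g : (Fin N → ℝ) → ℝ} (hf : SymMemLp f) (hg : SymMemLp g) :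
    SymMemLp fun v => f v - g v where
  memLp := hf.memLp.sub hg.memLp
  symm σ := by
    filter_upwards [hf.symm σ, hg.symm σ] with v hfv hgv
    rw [hfv, hgv]

lemma SymMemLp.const_mul {f : (Fin N → ℝ) → ℝ} (c : ℝ) (hf : SymMemLp f) :
    SymMemLp fun v => c * f v where
  memLp := hf.memLp.const_mul c
  symm σ := by
    filter_upwards [hf.symm σ] with v hv
    rw [hv]

variable (hρ : 0 < ρ) (hμ : 0 < μ)

lemma toSym_add {f g : (Fin N → ℝ) → ℝ} (hf : SymMemLp f) (hg : SymMemLp g) :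
    toSym hρ hμ f hf + toSym hρ hμ g hg = toSym hρ hμ _ (hf.add hg) := rfl

lemma smul_toSym {f : (Fin N → ℝ) → ℝ} (c : ℝ) (hf : SymMemLp f) :
    c • toSym hρ hμ f hf = toSym hρ hμ _ (hf.const_mul c) := rfl

lemma toSym_zero : toSym hρ hμ (fun _ : Fin N → ℝ => 0) (symMemLp_const 0) = 0 := rfl

/-- The creation operator on `symL2`. -/
noncomputable def raise (x : symL2 ρ μ N) : symL2 ρ μ (N + 1) :=
  toSym hρ hμ _ (symMemLp_coe hρ hμ x).plusF

/-- The annihilation operator on `symL2`. -/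
noncomputable def lower (x : symL2 ρ μ (N + 1)) : symL2 ρ μ N :=
  toSym hρ hμ _ (symMemLp_coe hρ hμ x).minusF

/-- The collision operator on `symL2`. -/
noncomputable def coll (x : symL2 ρ μ N) : symL2 ρ μ N :=
  toSym hρ hμ _ (symMemLp_coe hρ hμ x).kacF

lemma raise_toSym {f : (Fin N → ℝ) → ℝ} (hf : SymMemLp f) :
    raise hρ hμ (toSym hρ hμ f hf) = toSym hρ hμ _ hf.plusF :=
  toSym_congr hρ hμ _ _ (plusF_congr (coe_toSym hρ hμ hf))

lemma lower_toSym {f : (Fin (N + 1) → ℝ) → ℝ} (hf : SymMemLp f) :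
    lower hρ hμ (toSym hρ hμ f hf) = toSym hρ hμ _ hf.minusF :=
  toSym_congr hρ hμ _ _ (minusF_congr (coe_toSym hρ hμ hf))

lemma coll_toSym {f : (Fin N → ℝ) → ℝ} (hf : SymMemLp f) :
    coll hρ hμ (toSym hρ hμ f hf) = toSym hρ hμ _ hf.kacF :=
  toSym_congr hρ hμ _ _ (kacF_congr (coe_toSym hρ hμ hf))

lemma inner_raise (x : symL2 ρ μ N) (y : symL2 ρ μ (N + 1)) :
    inner ℝ (raise hρ hμ x) y = μ / ρ * inner ℝ x (lower hρ hμ y) := by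
  rw [raise, lower, inner_toSym_left, inner_toSym_right,
    integral_plusF_mul (symMemLp_coe hρ hμ x).memLp (symMemLp_coe hρ hμ y).memLp,
    ← mul_assoc, ← mul_assoc, ← succ_mul_weight_succ, mul_comm ((N : ℝ) + 1)]

lemma inner_coll (x y : symL2 ρ μ N) :
    inner ℝ (coll hρ hμ x) y = inner ℝ x (coll hρ hμ y) := by
  rw [coll, coll, inner_toSym_left, inner_toSym_right,
    integral_kacF_mul (symMemLp_coe hρ hμ x).memLp (symMemLp_coe hρ hμ y).memLp]

lemma inner_coll_self_nonpos (x : symL2 ρ μ N) : inner ℝ x (coll hρ hμ x) ≤ 0 := by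
  rw [coll, inner_toSym_right]
  exact mul_nonpos_of_nonneg_of_nonpos (weight_pos hρ hμ N).le
    (integral_mul_kacF_self_nonpos (symMemLp_coe hρ hμ x).memLp)

lemma lower_raise_zero (x : symL2 ρ μ 0) : lower hρ hμ (raise hρ hμ x) = x := by
  rw [raise, lower_toSym,
    toSym_congr hρ hμ _ (symMemLp_coe hρ hμ x) (symMemLp_coe hρ hμ x).minusF_plusF_zero, toSym_coe]

lemma lower_raise_succ (x : symL2 ρ μ (N + 1)) :
    lower hρ hμ (raise hρ hμ x) = raise hρ hμ (lower hρ hμ x) + x := by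
  have hx := symMemLp_coe hρ hμ x
  calc lower hρ hμ (raise hρ hμ x)
      = toSym hρ hμ _ hx.plusF.minusF := lower_toSym hρ hμ hx.plusF
    _ = toSym hρ hμ _ (hx.minusF.plusF.add hx) := toSym_congr hρ hμ _ _ hx.minusF_plusF
    _ = raise hρ hμ (lower hρ hμ x) + x := by
      rw [← toSym_add hρ hμ hx.minusF.plusF hx, toSym_coe, ← raise_toSym hρ hμ hx.minusF, lower]

lemma raise_const (c : ℝ) :
    raise hρ hμ (toSym hρ hμ _ (symMemLp_const (N := N) c)) =
      ((N : ℝ) + 1) • toSym hρ hμ _ (symMemLp_const c) := by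
  rw [raise_toSym, smul_toSym]
  exact toSym_congr hρ hμ _ _ (.of_forall fun v => by simp [plusF])

lemma coll_toSym_eq_zero {f : (Fin N → ℝ) → ℝ} (hf : SymMemLp f)
    (hrot : ∀ i j : Fin N, i ≠ j → ∀ θ v, f (rot i j θ v) = f v) :
    coll hρ hμ (toSym hρ hμ f hf) = 0 := by
  rw [coll_toSym, ← toSym_zero]
  exact toSym_congr hρ hμ _ _ (.of_forall (kacF_eq_zero_of_rot_invariant hrot))

lemma toSym_const_default (x : symL2 ρ μ 0) :
    toSym hρ hμ _ (symMemLp_const (x.1 default)) = x :=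
  (eq_toSym hρ hμ _ (.of_forall fun v => by rw [Subsingleton.elim v default])).symm

lemma inner_toSym_toSym {f g : (Fin N → ℝ) → ℝ} (hf : SymMemLp f) (hg : SymMemLp g) :
    inner ℝ (toSym hρ hμ f hf) (toSym hρ hμ g hg) = weight ρ μ N * ∫ v, f v * g v ∂gaussN N := by
  rw [inner_toSym_right]
  congr 1
  refine integral_congr_ae ?_
  filter_upwards [ae_gaussN_iff.2 (coe_toSym hρ hμ hf)] with v hv
  rw [hv]

lemma inner_const_const (c d : ℝ) :
    inner ℝ (toSym hρ hμ _ (symMemLp_const (N := N) c)) (toSym hρ hμ _ (symMemLp_const d)) =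
      weight ρ μ N * (c * d) := by
  rw [inner_toSym_toSym, integral_const, probReal_univ, one_smul]

lemma eq_zero_of_inner_one_eq_zero {x : symL2 ρ μ 0}
    (hx : inner ℝ x (toSym hρ hμ _ (symMemLp_const 1)) = 0) : x = 0 := by
  rw [← toSym_const_default hρ hμ x] at hx ⊢
  rw [inner_const_const, mul_one] at hx
  simp only [(mul_eq_zero.1 hx).resolve_left (weight_pos hρ hμ 0).ne']
  exact toSym_zero hρ hμ

/-- The ladder of the particle system with `ν = μ / ρ`. -/
noncomputable def ladder : Ladder (fun N => symL2 ρ μ N) (μ / ρ) where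
  raise _ := raise hρ hμ
  lower _ := lower hρ hμ
  coll _ := coll hρ hμ
  one _ := toSym hρ hμ _ (symMemLp_const 1)
  pos := div_pos hμ hρ
  inner_raise _ := inner_raise hρ hμ
  inner_coll _ := inner_coll hρ hμ
  inner_coll_self_nonpos _ := inner_coll_self_nonpos hρ hμ
  lower_raise_zero := lower_raise_zero hρ hμ
  lower_raise_succ _ := lower_raise_succ hρ hμ
  raise_one _ := raise_const hρ hμ 1
  coll_one _ := coll_toSym_eq_zero hρ hμ _ fun _ _ _ _ _ => rfl
  eq_zero_of_inner_one_eq_zero _ := eq_zero_of_inner_one_eq_zero hρ hμ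

end Ladder

section Generator

variable {ρ μ lam : ℝ}

lemma represents_iff (hρ : 0 < ρ) (hμ : 0 < μ) {g : Space ρ μ} {F : State} :
    Represents g F ↔ ∀ N, ∀ᵐ v, (g N).1 v = F N v :=
  forall_congr' fun _ => ae_level_iff hρ hμ

variable (hρ : 0 < ρ) (hμ : 0 < μ)

lemma coe_gen (h : Space ρ μ) (N : ℕ) :
    ∀ᵐ v, ((ladder hρ hμ).gen ρ lam h N).1 v = genExpr ρ μ lam (toState h) N v := by
  have hh (n : ℕ) := symMemLp_coe hρ hμ (h n)
  have hν : ρ * (μ / ρ) = μ := mul_div_cancel₀ μ hρ.ne'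
  cases N with
  | zero =>
    have hf := (((hh 1).minusF.sub (hh 0)).const_mul (ρ * (μ / ρ))).add ((hh 0).kacF.const_mul lam)
    have hgen : toSym hρ hμ _ hf = (ladder hρ hμ).gen ρ lam h 0 := by
      change (ρ * (μ / ρ)) • (toSym hρ hμ _ (hh 1).minusF - toSym hρ hμ _ (hh 0)) +
        lam • toSym hρ hμ _ (hh 0).kacF = _
      rw [toSym_coe]
      rfl
    rw [← hgen]
    filter_upwards [coe_toSym hρ hμ hf] with v hv
    rw [hv, hν, genExpr, Pplus, Num, Nat.cast_zero, zero_mul, sub_zero, mul_zero, zero_add]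
    rfl
  | succ n =>
    have hf := ((((hh n).plusF.sub ((hh (n + 1)).const_mul ((n : ℝ) + 1))).const_mul ρ).add
      (((hh (n + 2)).minusF.sub (hh (n + 1))).const_mul (ρ * (μ / ρ)))).add
      ((hh (n + 1)).kacF.const_mul lam)
    have hgen : toSym hρ hμ _ hf = (ladder hρ hμ).gen ρ lam h (n + 1) := by
      change ρ • (toSym hρ hμ _ (hh n).plusF - ((n : ℝ) + 1) • toSym hρ hμ _ (hh (n + 1))) +
        (ρ * (μ / ρ)) • (toSym hρ hμ _ (hh (n + 2)).minusF - toSym hρ hμ _ (hh (n + 1))) +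
        lam • toSym hρ hμ _ (hh (n + 1)).kacF = _
      rw [toSym_coe]
      rfl
    rw [← hgen]
    filter_upwards [coe_toSym hρ hμ hf] with v hv
    rw [hv, hν, genExpr, Num, Nat.cast_succ]
    rfl

lemma isMaximal_generator :
    (ladder hρ hμ).IsMaximal ρ lam (generator ρ μ lam hρ hμ) where
  mem_domain h g hg := ⟨g, (represents_iff hρ hμ).2 fun N => hg N ▸ coe_gen hρ hμ h N⟩
  apply h N := symL2_ext hρ hμ (by
    filter_upwards [(represents_iff hρ hμ).1 h.2.choose_spec N,
      coe_gen (lam := lam) hρ hμ h.1 N] with v hA hgen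
    exact hA.trans hgen.symm)

end Generator

section Hermite

/-- The second Hermite function `2πw² - 1` of the Gaussian measure `gauss`. -/
noncomputable def chi (w : ℝ) : ℝ := 2 * Real.pi * w ^ 2 - 1

lemma continuous_chi : Continuous chi := by
  unfold chi
  fun_prop

lemma integrable_pow_mul_exp_neg_pi_mul_sq (k : ℕ) :
    Integrable fun w : ℝ => w ^ k * Real.exp (-Real.pi * w ^ 2) := by
  have hk : (-1 : ℝ) < k := neg_one_lt_zero.trans_le k.cast_nonneg
  simpa only [Real.rpow_natCast] using integrable_rpow_mul_exp_neg_mul_sq Real.pi_pos hk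

lemma memLp_chi : MemLp chi 2 gauss := by
  rw [memLp_two_iff_integrable_sq continuous_chi.aestronglyMeasurable, integrable_gauss_iff]
  refine ((((integrable_pow_mul_exp_neg_pi_mul_sq 4).const_mul (4 * Real.pi ^ 2)).sub
    ((integrable_pow_mul_exp_neg_pi_mul_sq 2).const_mul (4 * Real.pi))).add
    (integrable_pow_mul_exp_neg_pi_mul_sq 0)).congr (.of_forall fun w => ?_)
  simp only [Pi.add_apply, Pi.sub_apply, chi]
  ring

lemma integrable_chi : Integrable chi gauss := memLp_chi.integrable one_le_two

lemma hasDerivAt_neg_mul_exp_neg_pi_mul_sq (w : ℝ) :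
    HasDerivAt (fun w : ℝ => -(w ^ 1 * Real.exp (-Real.pi * w ^ 2)))
      (Real.exp (-Real.pi * w ^ 2) * chi w) w := by
  have hexp := ((hasDerivAt_pow 2 w).const_mul (-Real.pi)).exp
  refine ((hasDerivAt_pow 1 w).mul hexp).neg.congr_deriv ?_
  simp only [chi]
  ring

lemma integral_chi : ∫ w, chi w ∂gauss = 0 := by
  rw [integral_gauss]
  exact integral_eq_zero_of_hasDerivAt_of_integrable hasDerivAt_neg_mul_exp_neg_pi_mul_sq
    (integrable_gauss_iff.1 integrable_chi) (integrable_pow_mul_exp_neg_pi_mul_sq 1).neg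

/-- The sum of `chi` over all particles. -/
noncomputable def chiSum (N : ℕ) (v : Fin N → ℝ) : ℝ := ∑ i, chi (v i)

variable {N : ℕ}

lemma symMemLp_chiSum (N : ℕ) : SymMemLp (chiSum N) where
  memLp := memLp_finsetSum _ fun i _ =>
    memLp_chi.comp_measurePreserving (measurePreserving_eval_gaussN i)
  symm σ := .of_forall fun v => Equiv.sum_comp σ fun i => chi (v i)

lemma integral_chiSum_sq_le (N : ℕ) :
    ∫ v, chiSum N v ^ 2 ∂gaussN N ≤ (N : ℝ) ^ 2 * ∫ w, chi w ^ 2 ∂gauss := by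
  have hint (i : Fin N) : Integrable (fun v : Fin N → ℝ => chi (v i) ^ 2) (gaussN N) :=
    (memLp_chi.comp_measurePreserving (measurePreserving_eval_gaussN i)).integrable_sq
  have heval (i : Fin N) : ∫ v, chi (v i) ^ 2 ∂gaussN N = ∫ w, chi w ^ 2 ∂gauss :=
    integral_comp_measurePreserving (measurePreserving_eval_gaussN i)
      (continuous_chi.pow 2).aestronglyMeasurable
  calc ∫ v, chiSum N v ^ 2 ∂gaussN N
      ≤ ∫ v, (N : ℝ) * ∑ i : Fin N, chi (v i) ^ 2 ∂gaussN N :=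
        integral_mono (symMemLp_chiSum N).memLp.integrable_sq
          ((integrable_finsetSum _ fun i _ => hint i).const_mul _) fun v => by
            simpa only [Finset.card_univ, Fintype.card_fin] using!
              sq_sum_le_card_mul_sum_sq (s := Finset.univ) (f := fun i => chi (v i))
    _ = (N : ℝ) ^ 2 * ∫ w, chi w ^ 2 ∂gauss := by
        rw [integral_const_mul, integral_finsetSum _ fun i _ => hint i]
        simp only [heval, Finset.sum_const, Finset.card_univ, Fintype.card_fin, nsmul_eq_mul]
        ring

lemma plusF_chiSum (v : Fin (N + 1) → ℝ) : plusF (chiSum N) v = (N : ℝ) * chiSum (N + 1) v := by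
  have hremove (i : Fin (N + 1)) : chiSum N (i.removeNth v) = chiSum (N + 1) v - chi (v i) := by
    simp only [chiSum, Fin.sum_univ_succAbove _ i, Fin.removeNth_apply, add_sub_cancel_left]
  simp only [plusF, hremove, Finset.sum_sub_distrib, Finset.sum_const, Finset.card_univ,
    Fintype.card_fin, nsmul_eq_mul, Nat.cast_succ]
  rw [← chiSum]
  ring

lemma minusF_chiSum : ∀ᵐ v : Fin N → ℝ, minusF (chiSum (N + 1)) v = chiSum N v := by
  filter_upwards [(symMemLp_chiSum (N + 1)).minusF_ae_eq] with v hv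
  have hcons (w : ℝ) : chiSum (N + 1) (Fin.cons w v) = chi w + chiSum N v := by
    simp only [chiSum, Fin.sum_univ_succ, Fin.cons_zero, Fin.cons_succ]
  simp only [hv, hcons]
  rw [integral_add integrable_chi (integrable_const _), integral_chi, integral_const,
    probReal_univ, one_smul, zero_add]

lemma chiSum_rot {i j : Fin N} (hij : i ≠ j) (θ : ℝ) (v : Fin N → ℝ) :
    chiSum N (rot i j θ v) = chiSum N v := by
  simp only [chiSum, chi, Finset.sum_sub_distrib, ← Finset.mul_sum, rot_sum_sq hij]

end Hermite

section Weights

variable (ρ μ : ℝ)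

lemma summable_mul_weight : Summable fun n : ℕ => (n : ℝ) * weight ρ μ n := by
  rw [← summable_nat_add_iff 1]
  refine ((hasSum_weight ρ μ).summable.mul_left (μ / ρ)).congr fun n => ?_
  rw [← succ_mul_weight_succ, Nat.cast_succ]

lemma summable_sq_mul_weight : Summable fun n : ℕ => (n : ℝ) ^ 2 * weight ρ μ n := by
  rw [← summable_nat_add_iff 1]
  refine (((summable_mul_weight ρ μ).add (hasSum_weight ρ μ).summable).mul_left (μ / ρ)).congr
    fun n => ?_
  rw [Nat.cast_succ]
  linear_combination (-((n : ℝ) + 1)) * succ_mul_weight_succ ρ μ n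

lemma summable_affine_sq_mul_weight (b d : ℝ) :
    Summable fun n : ℕ => (b * (n : ℝ) - d) ^ 2 * weight ρ μ n := by
  refine ((((summable_sq_mul_weight ρ μ).mul_left (b ^ 2)).sub
    ((summable_mul_weight ρ μ).mul_left (2 * b * d))).add
    ((hasSum_weight ρ μ).summable.mul_left (d ^ 2))).congr fun n => ?_
  ring

end Weights

section Vectors

lemma memℓp_two_of_summable {E : ℕ → Type*} [∀ n, NormedAddCommGroup (E n)] {x : ∀ n, E n}
    (hx : Summable fun n => ‖x n‖ ^ 2) : Memℓp x 2 :=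
  memℓp_gen (by simpa using hx)

variable {ρ μ : ℝ} (hρ : 0 < ρ) (hμ : 0 < μ)

lemma norm_toSym_const_sq {N : ℕ} (c : ℝ) :
    ‖toSym hρ hμ _ (symMemLp_const (N := N) c)‖ ^ 2 = c ^ 2 * weight ρ μ N := by
  rw [← real_inner_self_eq_norm_sq, inner_const_const]
  ring

/-- The vector whose component on level `N` is the constant function `c N`. -/
noncomputable def constVec (c : ℕ → ℝ) (hc : Summable fun n => c n ^ 2 * weight ρ μ n) :
    Space ρ μ :=
  ⟨fun n => toSym hρ hμ _ (symMemLp_const (c n)),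
    memℓp_two_of_summable (by simpa only [norm_toSym_const_sq] using hc)⟩

variable (c : ℕ → ℝ) (hc : Summable fun n => c n ^ 2 * weight ρ μ n)

lemma represents_constVec : Represents (constVec hρ hμ c hc) fun N _ => c N :=
  (represents_iff hρ hμ).2 fun N => coe_toSym hρ hμ (symMemLp_const (c N))

lemma constVec_apply (n : ℕ) : constVec hρ hμ c hc n = c n • (ladder hρ hμ).one n :=
  toSym_congr hρ hμ (symMemLp_const (c n)) ((symMemLp_const 1).const_mul (c n))
    (.of_forall fun _ => (mul_one _).symm)

lemma norm_sq_constVec : ‖constVec hρ hμ c hc‖ ^ 2 = ∑' n, c n ^ 2 * weight ρ μ n := by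
  rw [← (hasSum_norm_sq (constVec hρ hμ c hc)).tsum_eq]
  exact tsum_congr fun n => norm_toSym_const_sq hρ hμ (c n)

lemma inner_constVec_one (n : ℕ) :
    inner ℝ (constVec hρ hμ c hc n) ((ladder hρ hμ).one n) = c n * weight ρ μ n :=
  (inner_const_const hρ hμ (c n) 1).trans (by rw [mul_one, mul_comm])

lemma norm_toSym_chiSum_sq_le (n : ℕ) :
    ‖toSym hρ hμ _ (symMemLp_chiSum n)‖ ^ 2 ≤
      (∫ w, chi w ^ 2 ∂gauss) * ((n : ℝ) ^ 2 * weight ρ μ n) := by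
  rw [← real_inner_self_eq_norm_sq, inner_toSym_toSym]
  simp only [← sq]
  linarith [mul_le_mul_of_nonneg_left (integral_chiSum_sq_le n) (weight_pos hρ hμ n).le]

/-- The vector whose component on level `N` is `κ ∑ᵢ (2πvᵢ² - 1)`. -/
noncomputable def chiVec (κ : ℝ) : Space ρ μ :=
  ⟨fun n => κ • toSym hρ hμ _ (symMemLp_chiSum n), by
    refine Memℓp.const_smul (memℓp_two_of_summable ?_) κ
    exact (((summable_sq_mul_weight ρ μ).mul_left _).of_nonneg_of_le (fun _ => by positivity)
      fun n => norm_toSym_chiSum_sq_le hρ hμ n)⟩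

lemma coe_chiVec (κ : ℝ) (N : ℕ) : ∀ᵐ v, (chiVec hρ hμ κ N).1 v = κ * chiSum N v :=
  coe_toSym hρ hμ ((symMemLp_chiSum N).const_mul κ)

lemma isCoherent_toSym_chiSum :
    (ladder hρ hμ).IsCoherent fun n => toSym hρ hμ _ (symMemLp_chiSum n) where
  zero := by
    rw [← toSym_zero hρ hμ]
    exact toSym_congr hρ hμ _ _ (.of_forall fun v => Fin.sum_univ_zero _)
  raise n := (raise_toSym hρ hμ (symMemLp_chiSum n)).trans
    (toSym_congr hρ hμ _ ((symMemLp_chiSum (n + 1)).const_mul n) (.of_forall plusF_chiSum))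
  lower n := (lower_toSym hρ hμ (symMemLp_chiSum (n + 1))).trans
    (toSym_congr hρ hμ _ _ minusF_chiSum)
  coll n := coll_toSym_eq_zero hρ hμ _ fun _ _ hij => chiSum_rot hij

lemma isCoherent_chiVec (κ : ℝ) : (ladder hρ hμ).IsCoherent (chiVec hρ hμ κ) :=
  (isCoherent_toSym_chiSum hρ hμ).smul κ

end Vectors

section Rotation

variable {N : ℕ} {i j : Fin N}

lemma rot_rot (hij : i ≠ j) (θ α : ℝ) (v : Fin N → ℝ) :
    rot i j θ (rot i j α v) = rot i j (θ + α) v := by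
  funext k
  simp only [rot, Real.cos_add, Real.sin_add, if_true, hij.symm, if_false]
  split_ifs <;> ring

lemma periodic_rot (i j : Fin N) (v : Fin N → ℝ) :
    Function.Periodic (fun θ => rot i j θ v) (2 * Real.pi) := fun θ => by
  funext k
  simp only [rot, Real.cos_add_two_pi, Real.sin_add_two_pi]

lemma Rcol_rot (hij : i ≠ j) (f : (Fin N → ℝ) → ℝ) (α : ℝ) (v : Fin N → ℝ) :
    Rcol i j f (rot i j α v) = Rcol i j f v := by
  have hper : Function.Periodic (fun θ => f (rot i j θ v)) (2 * Real.pi) :=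
    (periodic_rot i j v).comp f
  simp only [Rcol, rot_rot hij]
  rw [intervalIntegral.integral_comp_add_right (fun θ => f (rot i j θ v)), zero_add,
    add_comm (2 * Real.pi), hper.intervalIntegral_add_eq α 0, zero_add]

lemma rot_finTwo (θ x y : ℝ) : rot (0 : Fin 2) 1 θ ![x, y] =
    ![x * Real.cos θ - y * Real.sin θ, x * Real.sin θ + y * Real.cos θ] := by
  funext k
  fin_cases k <;> simp [rot]

lemma ae_finTwo {p : (Fin 2 → ℝ) → Prop} (hp : ∀ᵐ v, p v) :
    ∀ᵐ x : ℝ, ∀ᵐ y : ℝ, p ![x, y] :=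
  Measure.ae_ae_of_ae_prod <|
    (volume_preserving_finTwoArrow ℝ).symm.quasiMeasurePreserving.ae hp

end Rotation

section Mehler

/-- The Mehler (Ornstein–Uhlenbeck) average of `φ` at the angle `π / 4`, which the invariance under
rotations relates to `φ` itself. -/
noncomputable def mehler (φ : ℝ → ℝ) (x : ℝ) : ℝ := ∫ y, φ ((√2)⁻¹ * (x + y)) ∂gauss

variable {φ : ℝ → ℝ}

/-- The kernel of `mehler` with respect to the Lebesgue measure, up to the factor `√2`. -/
noncomputable def mehlerKernel (x z : ℝ) : ℝ := Real.exp (-Real.pi * (x - √2 * z) ^ 2)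

lemma continuous_mehlerKernel : Continuous fun p : ℝ × ℝ => mehlerKernel p.1 p.2 := by
  unfold mehlerKernel
  fun_prop

lemma exp_mul_comp_inv_sqrt_two (φ : ℝ → ℝ) (x y : ℝ) :
    Real.exp (-Real.pi * y ^ 2) * φ ((√2)⁻¹ * (x + y)) =
      φ ((√2)⁻¹ * (x + y)) * mehlerKernel x ((√2)⁻¹ * (x + y)) := by
  rw [mehlerKernel, mul_inv_cancel_left₀ (Real.sqrt_ne_zero'.2 zero_lt_two), sub_add_cancel_left,
    neg_sq, mul_comm]

lemma integral_comp_inv_sqrt_two_mul_add (G : ℝ → ℝ) (x : ℝ) :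
    ∫ y, G ((√2)⁻¹ * (x + y)) = √2 * ∫ z, G z := by
  rw [integral_add_left_eq_self (fun y => G ((√2)⁻¹ * y)) x, Measure.integral_comp_mul_left G,
    inv_inv, abs_of_nonneg (Real.sqrt_nonneg 2), smul_eq_mul]

lemma mehler_eq (φ : ℝ → ℝ) (x : ℝ) : mehler φ x = √2 * ∫ z, φ z * mehlerKernel x z := by
  rw [mehler, integral_gauss]
  simp only [exp_mul_comp_inv_sqrt_two φ x]
  exact integral_comp_inv_sqrt_two_mul_add (fun z => φ z * mehlerKernel x z) x

lemma aestronglyMeasurable_of_gauss {f : ℝ → ℝ} (hf : AEStronglyMeasurable f gauss) :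
    AEStronglyMeasurable f volume :=
  hf.mono_ac (Measure.ae_le_iff_absolutelyContinuous.1 fun _ => ae_gauss_iff.1)

lemma mehlerKernel_le (x z : ℝ) :
    mehlerKernel x z ≤ Real.exp (Real.pi * x ^ 2) * Real.exp (-Real.pi * z ^ 2) := by
  rw [mehlerKernel, ← Real.exp_add, Real.exp_le_exp]
  have hsquare : 0 ≤ Real.pi * (z - √2 * x) ^ 2 := by positivity
  have hsqrt : √2 ^ 2 = 2 := Real.sq_sqrt zero_le_two
  linear_combination hsquare + (Real.pi * x ^ 2 - Real.pi * z ^ 2) * hsqrt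

lemma norm_mul_mehlerKernel_le (φ : ℝ → ℝ) {x M : ℝ} (hx : x ^ 2 ≤ M) (z : ℝ) :
    ‖φ z * mehlerKernel x z‖ ≤
      Real.exp (Real.pi * M) * ‖Real.exp (-Real.pi * z ^ 2) * φ z‖ := by
  rw [norm_mul, norm_mul, mehlerKernel, Real.norm_of_nonneg (Real.exp_pos _).le,
    Real.norm_of_nonneg (Real.exp_pos _).le, ← mehlerKernel]
  calc ‖φ z‖ * mehlerKernel x z
      ≤ ‖φ z‖ * (Real.exp (Real.pi * x ^ 2) * Real.exp (-Real.pi * z ^ 2)) := by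
        gcongr
        exact mehlerKernel_le x z
    _ ≤ ‖φ z‖ * (Real.exp (Real.pi * M) * Real.exp (-Real.pi * z ^ 2)) := by gcongr
    _ = _ := by ring

lemma aestronglyMeasurable_mul_mehlerKernel (hφ : Integrable φ gauss) (x : ℝ) :
    AEStronglyMeasurable (fun z => φ z * mehlerKernel x z) volume :=
  (aestronglyMeasurable_of_gauss hφ.aestronglyMeasurable).mul
    (continuous_mehlerKernel.comp (.prodMk_right x)).aestronglyMeasurable

lemma integrable_mul_mehlerKernel (hφ : Integrable φ gauss) (x : ℝ) :
    Integrable fun z => φ z * mehlerKernel x z :=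
  ((integrable_gauss_iff.1 hφ).norm.const_mul _).mono' (aestronglyMeasurable_mul_mehlerKernel hφ x)
    (.of_forall (norm_mul_mehlerKernel_le φ le_rfl))

lemma continuous_mehler (hφ : Integrable φ gauss) : Continuous (mehler φ) := by
  rw [funext (mehler_eq φ)]
  refine continuous_const.mul (continuous_iff_continuousAt.2 fun x₀ => ?_)
  have hnhds : ∀ᶠ x in nhds x₀, x ^ 2 ≤ x₀ ^ 2 + 1 :=
    ((continuous_pow 2).tendsto x₀).eventually_le_const (lt_add_one _)
  exact continuousAt_of_dominated
    (bound := fun z => Real.exp (Real.pi * (x₀ ^ 2 + 1)) * ‖Real.exp (-Real.pi * z ^ 2) * φ z‖)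
    (.of_forall (aestronglyMeasurable_mul_mehlerKernel hφ))
    (hnhds.mono fun x hx => .of_forall (norm_mul_mehlerKernel_le φ hx))
    ((integrable_gauss_iff.1 hφ).norm.const_mul _)
    (.of_forall fun z =>
      (continuous_const.mul (continuous_mehlerKernel.comp (.prodMk_left z))).continuousAt)

lemma integrable_comp_inv_sqrt_two (hφ : Integrable φ gauss) (x : ℝ) :
    Integrable (fun y => φ ((√2)⁻¹ * (x + y))) gauss := by
  rw [integrable_gauss_iff]
  simp only [exp_mul_comp_inv_sqrt_two φ x]
  exact ((integrable_mul_mehlerKernel hφ x).comp_mul_left'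
    (inv_ne_zero (Real.sqrt_ne_zero'.2 zero_lt_two))).comp_add_left x

lemma measurePreserving_neg_gauss : MeasurePreserving (fun y : ℝ => -y) gauss gauss :=
  measurePreserving_withDensity (Measure.measurePreserving_neg volume) (by fun_prop) fun y => by
    rw [neg_sq]

lemma ae_eq_two_mul_mehler (hφ : Integrable φ gauss) (hmean : ∫ w, φ w ∂gauss = 0)
    (h : ∀ᵐ x : ℝ, ∀ᵐ y : ℝ, φ ((√2)⁻¹ * (x - y)) + φ ((√2)⁻¹ * (x + y)) = φ x + φ y) :
    ∀ᵐ x : ℝ, φ x = 2 * mehler φ x := by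
  filter_upwards [h] with x hx
  have hadd := integrable_comp_inv_sqrt_two hφ x
  have hsub : Integrable (fun y => φ ((√2)⁻¹ * (x + -y))) gauss :=
    measurePreserving_neg_gauss.integrable_comp_of_integrable hadd
  have hsub_eq : ∫ y, φ ((√2)⁻¹ * (x + -y)) ∂gauss = mehler φ x :=
    integral_comp_measurePreserving measurePreserving_neg_gauss hadd.aestronglyMeasurable
  calc φ x = ∫ y, (φ x + φ y) ∂gauss := by
        rw [integral_add (integrable_const _) hφ, hmean, integral_const, probReal_univ, one_smul,
          add_zero]
    _ = ∫ y, (φ ((√2)⁻¹ * (x + -y)) + φ ((√2)⁻¹ * (x + y))) ∂gauss := by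
        refine integral_congr_ae (ae_gauss_iff.2 ?_)
        filter_upwards [hx] with y hy
        rw [← sub_eq_add_neg, hy]
    _ = 2 * mehler φ x := by
        rw [integral_add hsub hadd, hsub_eq, ← mehler, two_mul]

end Mehler

section Quadratic

lemma map_add_of_odd_of_nonneg {G H : Type*} [AddCommGroup G] [LinearOrder G]
    [IsOrderedAddMonoid G] [AddCommGroup H] {A : G → H} (hodd : A.Odd)
    (hadd : ∀ s t, 0 ≤ s → 0 ≤ t → A (s + t) = A s + A t) (u w : G) : A (u + w) = A u + A w := by
  have hsub_le (s t : G) (ht : 0 ≤ t) (hts : t ≤ s) : A (s - t) = A s - A t := by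
    rw [eq_sub_iff_add_eq, ← hadd _ _ (sub_nonneg.2 hts) ht, sub_add_cancel]
  have hsub (s t : G) (hs : 0 ≤ s) (ht : 0 ≤ t) : A (s - t) = A s - A t := by
    rcases le_total t s with hts | hst
    · exact hsub_le s t ht hts
    · rw [← neg_sub t s, hodd, hsub_le t s hs hst, neg_sub]
  rcases le_total 0 u with hu | hu <;> rcases le_total 0 w with hw | hw
  · exact hadd u w hu hw
  · simpa only [sub_neg_eq_add, hodd w] using hsub u (-w) hu (neg_nonneg.2 hw)
  · rw [add_comm u, add_comm (A u)]
    simpa only [sub_neg_eq_add, hodd u] using hsub w (-u) hw (neg_nonneg.2 hu)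
  · have hneg := hadd (-u) (-w) (neg_nonneg.2 hu) (neg_nonneg.2 hw)
    rwa [← neg_add, hodd, hodd, hodd, ← neg_add, neg_inj] at hneg

variable {ψ : ℝ → ℝ}

lemma add_eq_add_sqrt_of_rot (h : ∀ θ x y,
    ψ (x * Real.cos θ - y * Real.sin θ) + ψ (x * Real.sin θ + y * Real.cos θ) = ψ x + ψ y)
    (x y : ℝ) : ψ x + ψ y = ψ √(x ^ 2 + y ^ 2) + ψ 0 := by
  have hpolar := h (Complex.arg ⟨x, y⟩) ‖(⟨x, y⟩ : ℂ)‖ 0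
  rw [Complex.norm_mul_cos_arg, Complex.norm_mul_sin_arg, zero_mul, zero_mul, sub_zero,
    add_zero, Complex.norm_def, Complex.normSq_apply] at hpolar
  simpa only [sq] using hpolar

lemma exists_eq_add_mul_sq (hc : Continuous ψ)
    (h : ∀ x y, ψ x + ψ y = ψ √(x ^ 2 + y ^ 2) + ψ 0) : ∃ a : ℝ, ∀ x, ψ x = ψ 0 + a * x ^ 2 := by
  -- The odd extension of `u ↦ ψ √u - ψ 0`.
  let A (u : ℝ) : ℝ := ψ √u - ψ √(-u)
  have hA (u : ℝ) (hu : 0 ≤ u) : A u = ψ √u - ψ 0 := by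
    simp only [A, Real.sqrt_eq_zero_of_nonpos (neg_nonpos.2 hu)]
  have hodd : A.Odd := fun u => by simp only [A, neg_neg, neg_sub]
  have hadd (s t : ℝ) (hs : 0 ≤ s) (ht : 0 ≤ t) : A (s + t) = A s + A t := by
    have hst := h √s √t
    rw [Real.sq_sqrt hs, Real.sq_sqrt ht] at hst
    rw [hA _ hs, hA _ ht, hA _ (add_nonneg hs ht)]
    linarith
  have hAc : Continuous A := by fun_prop
  have hlin := map_real_smul (AddMonoidHom.mk' A (map_add_of_odd_of_nonneg hodd hadd)) hAc
  refine ⟨A 1, fun x => ?_⟩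
  have hx : A (x ^ 2 * 1) = x ^ 2 * A 1 := hlin (x ^ 2) 1
  have hsqrt := h x 0
  rw [zero_pow two_ne_zero, add_zero] at hsqrt
  rw [mul_one, hA _ (sq_nonneg x)] at hx
  linarith

end Quadratic

section TwoParticle

variable {φ : ℝ → ℝ}

lemma eq_of_ae_eq_of_rot {ψ : ℝ → ℝ} (hc : Continuous ψ) (hφψ : ∀ᵐ w, φ w = ψ w) {θ : ℝ}
    (hinv : ∀ᵐ v : Fin 2 → ℝ, φ (rot 0 1 θ v 0) + φ (rot 0 1 θ v 1) = φ (v 0) + φ (v 1))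
    (x y : ℝ) : ψ (x * Real.cos θ - y * Real.sin θ) + ψ (x * Real.sin θ + y * Real.cos θ) =
      ψ x + ψ y := by
  have heval (i : Fin 2) : ∀ᵐ v : Fin 2 → ℝ, φ (v i) = ψ (v i) :=
    (Measure.quasiMeasurePreserving_eval (fun _ : Fin 2 => (volume : Measure ℝ)) i).ae hφψ
  have hrot := (measurePreserving_rot (zero_ne_one (α := Fin 2)) θ).quasiMeasurePreserving
  have hcrot : Continuous (rot (0 : Fin 2) 1 θ) := (continuous_rot 0 1).comp (.prodMk_right θ)
  have hae : (fun v : Fin 2 → ℝ => ψ (rot 0 1 θ v 0) + ψ (rot 0 1 θ v 1)) =ᵐ[volume]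
      fun v => ψ (v 0) + ψ (v 1) := by
    filter_upwards [hinv, heval 0, heval 1, hrot.ae (heval 0), hrot.ae (heval 1)]
      with v hv h0 h1 hr0 hr1
    rw [← h0, ← h1, ← hr0, ← hr1, hv]
  have heq := (Continuous.ae_eq_iff_eq volume (by fun_prop) (by fun_prop)).1 hae
  simpa only [rot_finTwo, Matrix.cons_val_zero, Matrix.cons_val_one] using congrFun heq ![x, y]

lemma ae_eq_two_mul_mehler_of_rot (hφ : Integrable φ gauss) (hmean : ∫ w, φ w ∂gauss = 0)
    (hinv : ∀ᵐ v : Fin 2 → ℝ, φ (rot 0 1 (Real.pi / 4) v 0) + φ (rot 0 1 (Real.pi / 4) v 1) =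
      φ (v 0) + φ (v 1)) : ∀ᵐ x : ℝ, φ x = 2 * mehler φ x := by
  refine ae_eq_two_mul_mehler hφ hmean ?_
  filter_upwards [ae_finTwo hinv] with x hx
  filter_upwards [hx] with y hy
  simp only [rot_finTwo, Real.cos_pi_div_four, Real.sin_pi_div_four, Real.sqrt_div_self,
    Matrix.cons_val_zero, Matrix.cons_val_one] at hy
  rw [← hy]
  congr 2 <;> ring

lemma exists_eq_mul_chi_of_eq_add_mul_sq {ψ : ℝ → ℝ} (hmean : ∫ w, ψ w ∂gauss = 0) {b a : ℝ}
    (hψ : ∀ w, ψ w = b + a * w ^ 2) : ∃ t, ∀ w, ψ w = t * chi w := by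
  have hchi (w : ℝ) : ψ w = (b + a / (2 * Real.pi)) + a / (2 * Real.pi) * chi w := by
    rw [hψ w, chi]
    field_simp
    ring
  have hconst : b + a / (2 * Real.pi) = 0 := by
    rwa [funext hchi, integral_add (integrable_const _) (integrable_chi.const_mul _),
      integral_const_mul, integral_chi, mul_zero, add_zero, integral_const, probReal_univ,
      one_smul] at hmean
  exact ⟨a / (2 * Real.pi), fun w => by rw [hchi w, hconst, zero_add]⟩

lemma exists_ae_eq_mul_chi (hφ : Integrable φ gauss) (hmean : ∫ w, φ w ∂gauss = 0)
    (hinv : ∀ θ, ∀ᵐ v : Fin 2 → ℝ,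
      φ (rot 0 1 θ v 0) + φ (rot 0 1 θ v 1) = φ (v 0) + φ (v 1)) :
    ∃ t : ℝ, ∀ᵐ w, φ w = t * chi w := by
  have hmehler := ae_eq_two_mul_mehler_of_rot hφ hmean (hinv (Real.pi / 4))
  have hc : Continuous fun w => 2 * mehler φ w := continuous_const.mul (continuous_mehler hφ)
  obtain ⟨a, ha⟩ := exists_eq_add_mul_sq hc
    (add_eq_add_sqrt_of_rot fun θ => eq_of_ae_eq_of_rot hc hmehler (hinv θ))
  have hmean' : ∫ w, 2 * mehler φ w ∂gauss = 0 :=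
    (integral_congr_ae (ae_gauss_iff.2 hmehler)).symm.trans hmean
  obtain ⟨t, ht⟩ := exists_eq_mul_chi_of_eq_add_mul_sq hmean' ha
  exact ⟨t, hmehler.mono fun w hw => hw.trans (ht w)⟩

end TwoParticle

section LevelOne

lemma plusF_levelOne (f : (Fin 1 → ℝ) → ℝ) (v : Fin 2 → ℝ) :
    plusF f v = (f fun _ => v 0) + f fun _ => v 1 := by
  have hremove (i : Fin 2) : i.removeNth v = fun _ => v (i.succAbove 0) :=
    funext fun k => by rw [Subsingleton.elim k 0, Fin.removeNth_apply]
  rw [plusF, Fin.sum_univ_two, hremove, hremove, add_comm]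
  rfl

lemma kacF_levelTwo (f : (Fin 2 → ℝ) → ℝ) (v : Fin 2 → ℝ) : kacF f v = Rcol 0 1 f v - f v := by
  have hpairs : (Finset.univ.filter fun p : Fin 2 × Fin 2 => p.1 < p.2) = {(0, 1)} := by decide
  rw [kacF, hpairs, Finset.sum_singleton]

lemma ae_rot_eq_of_kacF_eq_zero {f : (Fin 2 → ℝ) → ℝ} (hf : ∀ᵐ v, kacF f v = 0) (θ : ℝ) :
    ∀ᵐ v, f (rot 0 1 θ v) = f v := by
  filter_upwards [hf, (measurePreserving_rot zero_ne_one θ).quasiMeasurePreserving.ae hf]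
    with v hv hrot
  rw [kacF_levelTwo, sub_eq_zero] at hv hrot
  rw [← hrot, Rcol_rot zero_ne_one, hv]

lemma measurePreserving_const_gaussN :
    MeasurePreserving (fun (w : ℝ) (_ : Fin 1) => w) gauss (gaussN 1) :=
  (measurePreserving_eval_gaussN (0 : Fin 1)).symm (MeasurableEquiv.funUnique (Fin 1) ℝ)

variable {ρ μ : ℝ} (hρ : 0 < ρ) (hμ : 0 < μ)

lemma ae_eq_zero_of_toSym_eq_zero {N : ℕ} {f : (Fin N → ℝ) → ℝ} {hf : SymMemLp f}
    (h : toSym hρ hμ f hf = 0) : ∀ᵐ v, f v = 0 := by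
  filter_upwards [coe_toSym hρ hμ hf, coe_toSym hρ hμ (symMemLp_const (N := N) 0)] with v hv h0
  rw [← hv, h, ← toSym_zero hρ hμ, h0]

lemma exists_eq_smul_toSym_chiSum {f : symL2 ρ μ 1} (hf : inner ℝ f ((ladder hρ hμ).one 1) = 0)
    (hcoll : coll hρ hμ (raise hρ hμ f) = 0) :
    ∃ t : ℝ, f = t • toSym hρ hμ _ (symMemLp_chiSum 1) := by
  have hfm := symMemLp_coe hρ hμ f
  have hint : Integrable (fun w => f.1 fun _ => w) gauss :=
    measurePreserving_const_gaussN.integrable_comp_of_integrable (hfm.memLp.integrable one_le_two)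
  have hmean : ∫ w, f.1 (fun _ => w) ∂gauss = 0 := by
    have hone := (inner_toSym_right hρ hμ (symMemLp_const 1) f).symm.trans hf
    simp only [mul_one] at hone
    rw [integral_comp_measurePreserving measurePreserving_const_gaussN
      hfm.memLp.aestronglyMeasurable]
    exact (mul_eq_zero.1 hone).resolve_left (weight_pos hρ hμ 1).ne'
  have hkac : ∀ᵐ v, kacF (plusF f.1) v = 0 :=
    ae_eq_zero_of_toSym_eq_zero hρ hμ ((coll_toSym hρ hμ hfm.plusF).symm.trans hcoll)
  obtain ⟨t, ht⟩ := exists_ae_eq_mul_chi hint hmean fun θ => by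
    simpa only [plusF_levelOne] using ae_rot_eq_of_kacF_eq_zero hkac θ
  refine ⟨t, eq_toSym hρ hμ ((symMemLp_chiSum 1).const_mul t) ?_⟩
  filter_upwards [ae_gaussN_iff.1 ((measurePreserving_eval_gaussN (0 : Fin 1)
    ).quasiMeasurePreserving.ae (ae_gauss_iff.2 ht))] with v hv
  rw [chiSum, Fin.sum_univ_one, ← hv]
  congr 1
  exact funext fun k => by rw [Subsingleton.elim k 0]

lemma exists_eq_smul_chiVec {κ : ℝ} (hκ : κ ≠ 0) {f : symL2 ρ μ 1}
    (hf : inner ℝ f ((ladder hρ hμ).one 1) = 0) (hcoll : coll hρ hμ (raise hρ hμ f) = 0) :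
    ∃ t : ℝ, f = t • chiVec hρ hμ κ 1 := by
  obtain ⟨t, ht⟩ := exists_eq_smul_toSym_chiSum hρ hμ hf hcoll
  exact ⟨t / κ, ht.trans (by
    change _ = (t / κ) • (κ • toSym hρ hμ _ (symMemLp_chiSum 1))
    rw [smul_smul, div_mul_cancel₀ t hκ])⟩

end LevelOne

section Eigenvectors

variable {ρ μ : ℝ} (hρ : 0 < ρ) (hμ : 0 < μ)

lemma div_mul_sqrt_inv_div (ρ μ : ℝ) : μ / ρ * √(ρ / μ) = √(μ / ρ) := by
  rw [← inv_div μ ρ, Real.sqrt_inv, ← div_eq_mul_inv, Real.div_sqrt]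

lemma stateE1_eq (ρ μ : ℝ) :
    stateE1 ρ μ = fun (N : ℕ) _ => √(ρ / μ) * (N : ℝ) - √(μ / ρ) := by
  funext N v
  cases N <;> simp [stateE1, Pplus, stateE0]

/-- The vacuum `e⁰` as an element of the Hilbert space. -/
noncomputable def vecE0 : Space ρ μ :=
  constVec hρ hμ (fun _ => 1) (by simpa using (hasSum_weight ρ μ).summable)

/-- The eigenvector `e₁` as an element of the Hilbert space. -/
noncomputable def vecE1 : Space ρ μ :=
  constVec hρ hμ (fun N => √(ρ / μ) * (N : ℝ) - √(μ / ρ)) (summable_affine_sq_mul_weight ρ μ _ _)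

lemma represents_vecE0 : Represents (vecE0 hρ hμ) stateE0 := represents_constVec hρ hμ _ _

lemma represents_vecE1 : Represents (vecE1 hρ hμ) (stateE1 ρ μ) := by
  rw [stateE1_eq]
  exact represents_constVec hρ hμ _ _

lemma vecE0_apply (n : ℕ) : vecE0 hρ hμ n = (ladder hρ hμ).one n :=
  (constVec_apply hρ hμ _ _ n).trans (one_smul ℝ _)

lemma norm_vecE0 : ‖vecE0 hρ hμ‖ = 1 := by
  have hsq : ‖vecE0 hρ hμ‖ ^ 2 = 1 := by
    rw [vecE0, norm_sq_constVec]
    simpa only [one_pow, one_mul] using (hasSum_weight ρ μ).tsum_eq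
  exact (pow_eq_one_iff_of_nonneg (norm_nonneg _) two_ne_zero).1 hsq

lemma vecE1_mem_eigenspace (lam : ℝ) :
    vecE1 hρ hμ ∈ eigenspace (generator ρ μ lam hρ hμ) (-ρ) :=
  (isMaximal_generator hρ hμ).mem_eigenspace_of_eq_affine_smul_one (div_mul_sqrt_inv_div ρ μ)
    (constVec_apply hρ hμ _ _)

lemma inner_vecE1_one_ne_zero : inner ℝ (vecE1 hρ hμ 0) ((ladder hρ hμ).one 0) ≠ 0 := by
  rw [vecE1, inner_constVec_one, Nat.cast_zero, mul_zero, zero_sub]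
  exact mul_ne_zero (neg_ne_zero.2 (Real.sqrt_pos.2 (div_pos hμ hρ)).ne') (weight_pos hρ hμ 0).ne'

lemma vecE1_ne_zero : vecE1 hρ hμ ≠ 0 := fun h =>
  inner_vecE1_one_ne_zero hρ hμ (by rw [h]; exact inner_zero_left _)

end Eigenvectors

end KacReservoir

open KacReservoir in
theorem theorem1 (ρ μ lam : ℝ) (hρ : 0 < ρ) (hμ : 0 < μ) (hlam : 0 < lam) :
    Dense ((generator ρ μ lam hρ hμ).domain : Set (Space ρ μ)) ∧
    IsSelfAdjoint (generator ρ μ lam hρ hμ) ∧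
    (∀ h : (generator ρ μ lam hρ hμ).domain,
      inner ℝ (h : Space ρ μ) (generator ρ μ lam hρ hμ h) ≤ 0) ∧
    ∃ e0 e1 e001 : Space ρ μ,
      Represents e0 stateE0 ∧ Represents e1 (stateE1 ρ μ) ∧ Represents e001 (stateE001 ρ μ) ∧
      IsLUB (rayleighValues (generator ρ μ lam hρ hμ) (Submodule.span ℝ {e0}))
        (gap (generator ρ μ lam hρ hμ) (Submodule.span ℝ {e0})) ∧
      gap (generator ρ μ lam hρ hμ) (Submodule.span ℝ {e0}) = -ρ ∧
      eigenspace (generator ρ μ lam hρ hμ)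
        (gap (generator ρ μ lam hρ hμ) (Submodule.span ℝ {e0})) ≠ ⊥ ∧
      eigenspace (generator ρ μ lam hρ hμ)
        (gap (generator ρ μ lam hρ hμ) (Submodule.span ℝ {e0})) =
          Submodule.span ℝ {e1, e001} := by
  have hA := isMaximal_generator (lam := lam) hρ hμ
  have he1 := vecE1_mem_eigenspace hρ hμ lam
  have hgreatest := hA.isGreatest_rayleighValues hρ hlam.le (vecE0_apply hρ hμ) (norm_vecE0 hρ hμ)
    he1 (vecE1_ne_zero hρ hμ)
  have hgap : gap (generator ρ μ lam hρ hμ) (Submodule.span ℝ {vecE0 hρ hμ}) = -ρ :=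
    hgreatest.csSup_eq
  have hκ : √(ρ / (2 * μ)) ≠ 0 := (Real.sqrt_pos.2 (by positivity)).ne'
  refine ⟨hA.dense_domain, hA.isSelfAdjoint, hA.inner_apply_nonpos hρ.le hlam.le, vecE0 hρ hμ,
    vecE1 hρ hμ, chiVec hρ hμ √(ρ / (2 * μ)), represents_vecE0 hρ hμ, represents_vecE1 hρ hμ,
    (represents_iff hρ hμ).2 (coe_chiVec hρ hμ _), ?_⟩
  rw [hgap]
  exact ⟨hgreatest.isLUB, rfl, (Submodule.ne_bot_iff _).2 ⟨_, he1, vecE1_ne_zero hρ hμ⟩,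
    hA.eigenspace_eq_span hρ hlam he1 (inner_vecE1_one_ne_zero hρ hμ)
      (isCoherent_chiVec hρ hμ _) fun _ => exists_eq_smul_chiVec hρ hμ hκ⟩
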